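/- **Notation.** For a finite set $I$ of positive integers let $\pm I=I\cup(-I)$, let $\delta(k)=-k$, and for $\varepsilon:I\to\{1,-1\}$ let $\delta_\varepsilon(k)=\varepsilon(|k|)\,k$ on $\pm I$. Permutations are composed right-to-left, and $\#(\pi)$ is the number of cycles of $\pi$ (fixed points included). $\mathrm{PM}(I)$ (the premaps) is the set of permutations $\pi$ of $\pm I$ with $\delta\pi\delta=\pi^{-1}$ such that $k$ and $-k$ are never in the same cycle; $\mathrm{PM}(n)=\mathrm{PM}([n])$. The cycles of a premap come in pairs exchanged by $\delta$ (with reversal of the order); $\mathrm{FD}(\pi)$ consists of those cycles in which the element of smallest absolute value is positive, and also denotes the set of their elements. For a permutation $\varphi$ of $I$ let $\varphi_+$ be $\varphi$ extended trivially to $\pm I$, $\varphi_-=\delta\varphi_+\delta$, and for $\alpha\in\mathrm{PM}(I)$ $$K(\varphi,\alpha)=\varphi_+^{-1}\alpha^{-1}\varphi_-,\qquad \chi(\varphi,\alpha)=\tfrac12\#(\varphi_+\varphi_-^{-1})+\tfrac12\#(\alpha)+\tfrac12\#(K(\varphi,\alpha))-|I|.$$ The quaternion $a+bi+cj+dk$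 is represented by the complex matrix $\begin{pmatrix}a+bi&c+di\\-c+di&a-bi\end{pmatrix}$, with rows and columns indexed by $1,-1$ in this order. For an $N\times N$ quaternionic matrix $A$, $A_{i,j;\eta,\theta}$ is the $(\eta,\theta)$ entry of the matrix representing the quaternion $A_{i,j}$; the adjoint $A^*$ is the conjugate transpose. Given $A_1,\dots,A_n$, put $A^{(k)}=A_k$ and $A^{(-k)}=A_k^*$ for $k\in[n]$; likewise $A_k^{(1)}=A_k$ and $A_k^{(-1)}=A_k^*$. For $\pi,\rho\in\mathrm{PM}(n)$ define $$\mathrm{Re}_{\mathrm{FD}(\pi)}\mathrm{tr}_{\mathrm{FD}(\rho)}(A_1,\dots,A_n)=2^{-\#(\pi)/2}N^{-\#(\rho)/2}\sum_{i,h}\ \prod_{k\in\mathrm{FD}(\pi)}A^{(k)}_{i_k,i_{\rho(k)};h_k,h_{\pi(k)}},$$ where the sum is over all $h:\mathrm{FD}(\pi)\to\{1,-1\}$ and all $i:\pm[n]\to[N]$ with $i_{\rho(k)}=i_{-k}$ for all $k\in\pm[n]$. For permutations $\varphi,\psi$ of $[n]$, $\mathrm{Re}_\varphi\mathrm{tr}_\psi$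 means $\mathrm{Re}_{\mathrm{FD}(\pi)}\mathrm{tr}_{\mathrm{FD}(\rho)}$ with $\pi=\varphi_+\varphi_-^{-1}$, $\rho=\psi_+\psi_-^{-1}$. **Proposition.** Let $N\ge1$. For each $c\in[C]$ let $X_{c,1},\dots,X_{c,n}$ be random $N\times N$ quaternionic matrices, the families for different $c$ being mutually independent. Suppose that for every $c\in[C]$, every $I\subseteq[n]$, every $\iota:\pm I\to[N]$ and every $\eta:\pm I\to\{1,-1\}$ the following expectation exists and $$\mathbb{E}\Big(\prod_{k\in I}(X_{c,k})_{\iota_k,\iota_{-k};\eta_k,\eta_{-k}}\Big)=\sum_{\alpha}\Big[\prod_{k\in I,\,-k\in\mathrm{FD}(\alpha)}\eta_k\eta_{-k}\Big](2N)^{\#(\alpha)/2-|I|}f_c(\alpha),$$ where the sum is over the $\alpha\in\mathrm{PM}(I)$ with $\iota_k=\iota_{-\alpha(k)}$ and $\mathrm{sgn}(k)\,\eta_k=\mathrm{sgn}(\alpha(k))\,\eta_{-\alpha(k)}$ for all $k\in\pm I$, for some functions $f_c:\mathrm{PM}(I)\to\mathbb{C}$ (one for each $I$). Let $\varphi_{\mathrm{Re}},\varphi_{\mathrm{tr}}\in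 S_n$, $w:[n]\to[C]$, $X_k=X_{w(k),k}$ and $\varepsilon:[n]\to\{1,-1\}$. Let $Y_1,\dots,Y_n$ be random $N\times N$ quaternionic matrices such that $(Y_1,\dots,Y_n)$ is independent from $(X_1,\dots,X_n)$ and every product of one complex entry of each of $Y_1,\dots,Y_n$ is integrable. Then $\mathrm{Re}_{\varphi_{\mathrm{Re}}}\mathrm{tr}_{\varphi_{\mathrm{tr}}}(X_1^{(\varepsilon(1))}Y_1,\dots,X_n^{(\varepsilon(n))}Y_n)$ is integrable, and, writing $\alpha^\varepsilon=\delta_\varepsilon\alpha\delta_\varepsilon$, $$\begin{aligned}&\mathbb{E}\big(\mathrm{Re}_{\varphi_{\mathrm{Re}}}\mathrm{tr}_{\varphi_{\mathrm{tr}}}(X_1^{(\varepsilon(1))}Y_1,\dots,X_n^{(\varepsilon(n))}Y_n)\big)\\&=\sum_{\substack{\alpha=\alpha_1\cdots\alpha_C\\ \alpha_c\in\mathrm{PM}(w^{-1}(c))}}(-2)^{\chi(\varphi_{\mathrm{Re}},\alpha^\varepsilon)-2\#(\varphi_{\mathrm{Re}})}N^{\chi(\varphi_{\mathrm{tr}},\alpha^\varepsilon)-2\#(\varphi_{\mathrm{tr}})}f_1(\alpha_1)\cdots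 f_C(\alpha_C)\\&\qquad\times\mathbb{E}\big(\mathrm{Re}_{\mathrm{FD}(K(\varphi_{\mathrm{Re}},\alpha^\varepsilon)^{-1})}\mathrm{tr}_{\mathrm{FD}(K(\varphi_{\mathrm{tr}},\alpha^\varepsilon)^{-1})}(Y_1,\dots,Y_n)\big).\end{aligned}$$ -/

import Mathlib

open MeasureTheory ProbabilityTheory

/-! ### Signed indices, premaps, Euler characteristic

For a finite linearly ordered set `ι`, the set `±ι` is `ι × ℤˣ`: the pair `(k, 1)` is the
index `k`, the pair `(k, -1)` is the index `-k`, and the first coordinate is the absolute value. -/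

namespace QuatExpansion

/-- The number of cycles of a permutation, fixed points included. -/
noncomputable def numCycles {β : Type*} (π : Equiv.Perm β) : ℕ :=
  Nat.card (Quotient (Equiv.Perm.SameCycle.setoid π))

/-- For `ε : ι → {1, -1}`, the permutation `k ↦ ε(|k|) k` of `±ι`. -/
def signFlip {ι : Type*} (ε : ι → ℤˣ) : Equiv.Perm (ι × ℤˣ) where
  toFun p := (p.1, ε p.1 * p.2)
  invFun p := (p.1, ε p.1 * p.2)
  left_inv p := by ext <;> simp [← mul_assoc]
  right_inv p := by ext <;> simp [← mul_assoc]

/-- The permutation `k ↦ -k` of `±ι`. -/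
def delta (ι : Type*) : Equiv.Perm (ι × ℤˣ) := signFlip fun _ => -1

/-- The premaps: `δ π δ = π⁻¹`, and `k`, `-k` never lie in the same cycle of `π`. -/
def IsPremap {ι : Type*} (π : Equiv.Perm (ι × ℤˣ)) : Prop :=
  delta ι * π * delta ι = π⁻¹ ∧ ∀ k, ¬ π.SameCycle k (delta ι k)

/-- The set `PM(ι)` of premaps on `±ι`. -/
def PM (ι : Type*) : Type _ := {π : Equiv.Perm (ι × ℤˣ) // IsPremap π}

instance {ι : Type*} [Finite ι] : Finite (PM ι) :=
  inferInstanceAs (Finite {π : Equiv.Perm (ι × ℤˣ) // IsPremap π})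

noncomputable instance {ι : Type*} [Finite ι] : Fintype (PM ι) := Fintype.ofFinite _

open Classical in
/-- The set `FD(π)`: the elements of those cycles of `π` in which the smallest absolute value
occurs with a positive sign. -/
noncomputable def FD {ι : Type*} [Fintype ι] [LinearOrder ι] (π : Equiv.Perm (ι × ℤˣ)) :
    Finset (ι × ℤˣ) :=
  Finset.univ.filter fun k =>
    ∃ m : ι, π.SameCycle k (m, 1) ∧ ∀ j, π.SameCycle k j → m ≤ j.1

theorem apply_mem_FD {ι : Type*} [Fintype ι] [LinearOrder ι] (π : Equiv.Perm (ι × ℤˣ))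
    (k : ι × ℤˣ) : π k ∈ FD π ↔ k ∈ FD π := by
  simp [FD, Equiv.Perm.sameCycle_apply_left]

/-- `FD(π)` as a permutation of its own set of elements. -/
noncomputable def fdPerm {ι : Type*} [Fintype ι] [LinearOrder ι] (π : Equiv.Perm (ι × ℤˣ)) :
    Equiv.Perm (FD π) :=
  π.subtypePerm (apply_mem_FD π)

/-- `φ₊`: the permutation `φ` acting on the positive elements of `±ι`, trivial on the others. -/
def posPerm {ι : Type*} (φ : Equiv.Perm ι) : Equiv.Perm (ι × ℤˣ) where
  toFun p := (if p.2 = 1 then φ p.1 else p.1, p.2)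
  invFun p := (if p.2 = 1 then φ⁻¹ p.1 else p.1, p.2)
  left_inv p := by rcases p with ⟨k, s⟩; by_cases h : s = 1 <;> simp [h]
  right_inv p := by rcases p with ⟨k, s⟩; by_cases h : s = 1 <;> simp [h]

/-- `φ₋ = δ φ₊ δ`. -/
def negPerm {ι : Type*} (φ : Equiv.Perm ι) : Equiv.Perm (ι × ℤˣ) :=
  delta ι * posPerm φ * delta ι

/-- The premap `φ₊ φ₋⁻¹`, whose `FD` is `φ` itself (acting on the positive elements). -/
def facePremap {ι : Type*} (φ : Equiv.Perm ι) : Equiv.Perm (ι × ℤˣ) :=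
  posPerm φ * (negPerm φ)⁻¹

/-- The vertex permutation `K(φ, α) = φ₊⁻¹ α⁻¹ φ₋`. -/
def vertexPerm {ι : Type*} (φ : Equiv.Perm ι) (α : Equiv.Perm (ι × ℤˣ)) :
    Equiv.Perm (ι × ℤˣ) :=
  (posPerm φ)⁻¹ * α⁻¹ * negPerm φ

/-- The Euler characteristic
`χ(φ, α) = #(φ₊ φ₋⁻¹)/2 + #(α)/2 + #(K(φ, α))/2 - |ι|`. For a premap `α` the three numbers of
cycles are even, since the cycles of a premap come in pairs, so the divisions are exact. -/
noncomputable def eulerChar {ι : Type*} [Fintype ι] (φ : Equiv.Perm ι)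
    (α : Equiv.Perm (ι × ℤˣ)) : ℤ :=
  (numCycles (facePremap φ) : ℤ) / 2 + (numCycles α : ℤ) / 2
    + (numCycles (vertexPerm φ α) : ℤ) / 2 - Fintype.card ι

/-- The set `w⁻¹(c)`. -/
def colourClass {n C : ℕ} (w : Fin n → Fin C) (c : Fin C) : Finset (Fin n) :=
  Finset.univ.filter fun k => w k = c

/-- A permutation of `±I`, extended trivially to a permutation of `±[n]`. -/
def extendTrivially {n : ℕ} (I : Finset (Fin n)) (π : Equiv.Perm (I × ℤˣ)) :
    Equiv.Perm (Fin n × ℤˣ) :=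
  π.extendDomain (p := fun x : Fin n × ℤˣ => x.1 ∈ I)
    (Equiv.prodSubtypeFstEquivSubtypeProd (p := fun k => k ∈ I)).symm

/-- The product `α = α_1 ⋯ α_C` of premaps on the sets `w⁻¹(c)`. -/
def premapProd {n C : ℕ} {w : Fin n → Fin C} (α : ∀ c, PM (colourClass w c)) :
    Equiv.Perm (Fin n × ℤˣ) :=
  (List.ofFn fun c => extendTrivially (colourClass w c) (α c).1).prod

/-! ### Quaternionic matrices -/

noncomputable instance : MeasurableSpace (Quaternion ℝ) := borel _

instance : BorelSpace (Quaternion ℝ) := ⟨rfl⟩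

/-- The `2 × 2` complex matrix `[[a + b i, c + d i], [-c + d i, a - b i]]` representing the
quaternion `a + b i + c j + d k`; rows and columns are indexed by `1, -1`, in this order. -/
noncomputable def quatMatrix (q : Quaternion ℝ) : Matrix ℤˣ ℤˣ ℂ := fun η θ =>
  if η = 1 then
    if θ = 1 then ⟨q.re, q.imI⟩ else ⟨q.imJ, q.imK⟩
  else
    if θ = 1 then ⟨-q.imJ, q.imK⟩ else ⟨q.re, -q.imI⟩

/-- The complex number `A_{i, j; η, θ}`. -/
noncomputable def entry {N : ℕ} (A : Matrix (Fin N) (Fin N) (Quaternion ℝ)) (i j : Fin N) (η θ : ℤˣ) : ℂ :=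
  quatMatrix (A i j) η θ

/-- `A^{(k)}` for a signed index `k`: the matrix `A_k` for `k > 0`, and the adjoint (conjugate
transpose) of `A_{|k|}` for `k < 0`. -/
noncomputable def signedMatrix {ι : Type*} {N : ℕ} (A : ι → Matrix (Fin N) (Fin N) (Quaternion ℝ))
    (k : ι × ℤˣ) : Matrix (Fin N) (Fin N) (Quaternion ℝ) :=
  if k.2 = 1 then A k.1 else (A k.1).conjTranspose

/-- `Re_{FD(π)} tr_{FD(ρ)} (A_1, …, A_n)` for premaps `π`, `ρ`. The matrix index `i k` is the left
index of `A^{(k)}`, for every signed `k`. Its right index is `i (ρ k)`; as the right index of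
`A^{(k)}` is the left index of its adjoint `A^{(-k)}`, the family `i` is subject to
`i (ρ k) = i (-k)`, which leaves `n` free indices. The normalisation is by the numbers of cycles of
`FD(π)` and `FD(ρ)`, that is, by half the numbers of cycles of `π` and `ρ`. -/
noncomputable def reTr {ι : Type*} [Fintype ι] [LinearOrder ι] {N : ℕ}
    (π ρ : Equiv.Perm (ι × ℤˣ)) (A : ι → Matrix (Fin N) (Fin N) (Quaternion ℝ)) : ℂ :=
  (2 : ℂ) ^ (-((numCycles π : ℤ) / 2)) * (N : ℂ) ^ (-((numCycles ρ : ℤ) / 2)) *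
    ∑ i : ι × ℤˣ → Fin N with ∀ k, i (ρ k) = i (delta ι k),
      ∑ h : FD π → ℤˣ,
        ∏ k : FD π, entry (signedMatrix A k) (i k) (i (ρ k)) (h k) (h (fdPerm π k))

/-- The right-hand side of the moment formula on a set `ι` of indices: the sum over the premaps
`α` with `i = i ∘ δα` and `sgn · η = (sgn ∘ α) · (η ∘ δα)` of
`[∏_{k ∈ ι, -k ∈ FD(α)} η_k η_{-k}] (2N)^{#(α)/2 - |ι|} f(α)`. -/
noncomputable def momentSum {ι : Type*} [Fintype ι] [LinearOrder ι] {N : ℕ} (f : PM ι → ℂ)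
    (i : ι × ℤˣ → Fin N) (η : ι × ℤˣ → ℤˣ) : ℂ :=
  ∑ α : PM ι with (∀ k, i k = i (delta ι (α.1 k))) ∧
      (∀ k, k.2 * η k = (α.1 k).2 * η (delta ι (α.1 k))),
    (∏ k : ι with (k, -1) ∈ FD α.1, (((η (k, 1) * η (k, -1) : ℤˣ) : ℤ) : ℂ)) *
      (2 * N : ℂ) ^ ((numCycles α.1 : ℤ) / 2 - Fintype.card ι) * f α

end QuatExpansion

open QuatExpansion

namespace QuatExpansion

/-! ### Cycles of permutations -/

section Cycles

open Equiv.Perm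

/-! Expanding each product into complex entries, with the intermediate index stored at `-k`, gives
terms made of entries of the `X` and entries of the `Y`, all read off one labelling of ±[n].
Independence separates `X` from `Y` and the colours from each other (`integral_prod_entry`). The
moment formula then makes the `X` part a sum over premaps α that constrain the labelling, and the
adjoints prescribed by ε replace α by β = α^ε. For fixed α a constrained sum of `Y` entries is left.
Since φ₊δ carries the involution δK(φ,β) to δβ, substitution along it yields the constraints of the
trace along K⁻¹ (`sum_index_eq`, `sum_sign_eq`).

The substance is the sign. Both β and K contribute factors η_k η_{-k} for the negative elements of a
half, and the product of the two contributions must not depend on the labelling. As for Pfaffians,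
each is read as the sign of a permutation. Let v change sign along δβ. All permutations that take δ
to δβ and the positive indices to {v = 1} have one sign, because two of them differ by two copies of
a single permutation (`sign_eq_sign_of_alternating`). A half of β provides one such permutation
(`IsPremap.exists_sign_eq`); a half of K, transported by φ₊δ, provides another. Comparing them
leaves only the signs of φ and of β and K on halves, which are cycle counts: the result is (-1)^(n +
#φ + #β/2 + #K/2) (`prod_mul_prod_dualSign`). This is the parity of χ, whence the base -2; the
powers of 2 and N are bookkeeping (`prefactor_eq`). -/

theorem numCycles_eq_of_sameCycle_iff {β γ : Type*} {π : Equiv.Perm β} {σ : Equiv.Perm γ}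
    (e : β ≃ γ) (h : ∀ x y, π.SameCycle x y ↔ σ.SameCycle (e x) (e y)) :
    numCycles π = numCycles σ :=
  Nat.card_congr (Quotient.congr e h)

/-- Intertwining passes to all integer powers. Injectivity of `e` suffices, so the lemma also
compares a permutation with its restriction to an invariant subset. -/
theorem sameCycle_iff_of_semiconj {β γ : Type*} {π : Equiv.Perm β} {σ : Equiv.Perm γ}
    {e : β → γ} (he : Function.Injective e) (h : ∀ x, e (π x) = σ (e x)) (x y : β) :
    π.SameCycle x y ↔ σ.SameCycle (e x) (e y) := by
  have hinv : ∀ x, e (π⁻¹ x) = σ⁻¹ (e x) := fun x => by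
    rw [Equiv.Perm.eq_inv_iff_eq, ← h, ← Equiv.Perm.mul_apply, mul_inv_cancel, Equiv.Perm.one_apply]
  have hz : ∀ (m : ℤ) (x : β), e ((π ^ m) x) = (σ ^ m) (e x) := by
    intro m
    induction m with
    | zero => intro x; simp
    | succ m ih => intro x; rw [zpow_add_one, zpow_add_one, mul_apply, mul_apply, ih, h]
    | pred m ih => intro x; rw [zpow_sub_one, zpow_sub_one, mul_apply, mul_apply, ih, hinv]
  simp only [SameCycle, ← hz, he.eq_iff]

theorem apply_eq_of_sameCycle {β γ : Type*} {π : Equiv.Perm β} {g : β → γ}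
    (h : ∀ x, g (π x) = g x) {x y : β} (hxy : π.SameCycle x y) : g x = g y := by
  have hinv : ∀ x, g (π⁻¹ x) = g x := fun x => by
    rw [← h, ← mul_apply, mul_inv_cancel, one_apply]
  obtain ⟨m, rfl⟩ := hxy
  induction m with
  | zero => simp
  | succ m ih => rw [add_comm, zpow_one_add, mul_apply, h, ih]
  | pred m ih => rw [sub_eq_neg_add, zpow_add, zpow_neg_one, mul_apply, hinv, ih]

theorem numCycles_eq_of_semiconj {β γ : Type*} {π : Equiv.Perm β} {σ : Equiv.Perm γ}
    (e : β ≃ γ) (h : ∀ x, e (π x) = σ (e x)) : numCycles π = numCycles σ :=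
  numCycles_eq_of_sameCycle_iff e (sameCycle_iff_of_semiconj e.injective h)

theorem numCycles_inv {β : Type*} (π : Equiv.Perm β) : numCycles π⁻¹ = numCycles π :=
  numCycles_eq_of_sameCycle_iff (Equiv.refl β) fun _ _ => sameCycle_inv

theorem numCycles_conj_inv {β : Type*} (g π : Equiv.Perm β) :
    numCycles (g * π * g⁻¹) = numCycles π :=
  (numCycles_eq_of_semiconj g fun x => by simp).symm

/-- A permutation preserving the fibres of an equivalence `(Σ c, β c) ≃ γ` has as many cycles
as its restrictions to the fibres have together. -/
theorem numCycles_eq_sum_of_sigma {κ : Type*} [Fintype κ] {β : κ → Type*} [∀ c, Finite (β c)]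
    {γ : Type*} {π : ∀ c, Equiv.Perm (β c)} {σ : Equiv.Perm γ} (e : (Σ c, β c) ≃ γ)
    (h : ∀ c x, e ⟨c, π c x⟩ = σ (e ⟨c, x⟩)) :
    numCycles σ = ∑ c, numCycles (π c) := by
  have hs : numCycles σ = numCycles (Equiv.Perm.sigmaCongrRight π) :=
    (numCycles_eq_of_semiconj e fun x => h x.1 x.2).symm
  have hsame : ∀ c (x y : β c), (π c).SameCycle x y ↔
      (Equiv.Perm.sigmaCongrRight π).SameCycle ⟨c, x⟩ ⟨c, y⟩ := fun c x y =>
    sameCycle_iff_of_semiconj (e := Sigma.mk c) sigma_mk_injective (fun _ => rfl) x y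
  have hfst : ∀ x y : (Σ c, β c), (Equiv.Perm.sigmaCongrRight π).SameCycle x y → x.1 = y.1 :=
    fun x y => apply_eq_of_sameCycle (g := Sigma.fst) fun _ => rfl
  rw [hs]
  simp only [numCycles]
  rw [← Nat.card_sigma]
  symm
  refine Nat.card_eq_of_bijective (fun q : Σ c, Quotient (SameCycle.setoid (π c)) =>
    Quotient.map (sa := SameCycle.setoid (π q.1))
      (sb := SameCycle.setoid (Equiv.Perm.sigmaCongrRight π))
      (Sigma.mk q.1) (fun x y hxy => (hsame q.1 x y).1 hxy) q.2) ⟨?_, ?_⟩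
  · rintro ⟨c, a⟩ ⟨d, b⟩ hab
    induction a using Quotient.inductionOn
    induction b using Quotient.inductionOn
    have hab' := Quotient.exact hab
    obtain rfl : c = d := hfst _ _ hab'
    exact congrArg (Sigma.mk c) (Quotient.sound ((hsame c _ _).2 hab'))
  · intro q
    induction q using Quotient.inductionOn with
    | h x => exact ⟨⟨x.1, Quotient.mk _ x.2⟩, rfl⟩

/-- A cycle of length l has sign (-1)^(l-1), and the lengths add up to the cardinality. -/
theorem sign_eq_neg_one_pow_card_add_numCycles {β : Type*} [Fintype β] [DecidableEq β]
    (σ : Equiv.Perm β) : sign σ = (-1) ^ (Fintype.card β + numCycles σ) := by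
  have hcard : numCycles σ = σ.cycleFactorsFinset.card
      + Fintype.card (Function.fixedPoints σ) := by
    have hf : ∀ x, σ.cycleOf x ∈ σ.cycleFactorsFinset ↔ x ∉ Function.fixedPoints σ := fun x => by
      rw [cycleOf_mem_cycleFactorsFinset_iff, mem_support]; rfl
    -- `cycleFactorsFinset` omits trivial cycles, so fixed points label themselves.
    let g : β → σ.cycleFactorsFinset ⊕ Function.fixedPoints σ := fun x =>
      if hx : x ∈ Function.fixedPoints σ then Sum.inr ⟨x, hx⟩
      else Sum.inl ⟨σ.cycleOf x, (hf x).2 hx⟩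
    have hg : ∀ x y, σ.SameCycle x y ↔ g x = g y := by
      intro x y
      by_cases hx : x ∈ Function.fixedPoints σ <;> by_cases hy : y ∈ Function.fixedPoints σ
      · simp only [g, hx, hy, dif_pos, Sum.inr.injEq, Subtype.mk.injEq]
        exact ⟨fun h => h.eq_of_left hx, fun h => h ▸ SameCycle.refl _ _⟩
      · simp only [g, hx, hy, dif_pos, dif_neg, not_false_eq_true, reduceCtorEq, iff_false]
        exact fun h => hy ((h.apply_eq_self_iff).1 hx)
      · simp only [g, hx, hy, dif_pos, dif_neg, not_false_eq_true, reduceCtorEq, iff_false]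
        exact fun h => hx ((h.apply_eq_self_iff).2 hy)
      · simp only [g, hx, hy, dif_neg, not_false_eq_true, Sum.inl.injEq, Subtype.mk.injEq]
        exact sameCycle_iff_cycleOf_eq_of_mem_support (mem_support.2 hx) (mem_support.2 hy)
    have hsurj : Function.Surjective g := by
      rintro (⟨c, hc⟩ | ⟨x, hx⟩)
      · obtain ⟨x, hx⟩ := (mem_cycleFactorsFinset_iff.1 hc).1.nonempty_support
        have hxc := (cycle_is_cycleOf hx hc)
        refine ⟨x, ?_⟩
        have hx' : x ∉ Function.fixedPoints σ := (hf x).1 (hxc ▸ hc)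
        simp only [g, hx', dif_neg, not_false_eq_true, hxc]
      · exact ⟨x, by simp only [g, hx, dif_pos]⟩
    have : numCycles σ = Nat.card (σ.cycleFactorsFinset ⊕ Function.fixedPoints σ) := by
      refine Nat.card_eq_of_bijective
        (Quotient.lift g fun x y h => (hg x y).1 h) ⟨?_, ?_⟩
      · intro a b
        induction a using Quotient.inductionOn
        induction b using Quotient.inductionOn
        exact fun h => Quotient.sound ((hg _ _).2 h)
      · intro z
        obtain ⟨x, rfl⟩ := hsurj z
        exact ⟨Quotient.mk _ x, rfl⟩
    rw [this]
    simp [Nat.card_eq_fintype_card]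
  have h1 := σ.card_fixedPoints
  have h2 := σ.sum_cycleType_le
  have h3 : Multiset.card σ.cycleType = σ.cycleFactorsFinset.card := by simp [cycleType_def]
  rw [sign_of_cycleType, hcard, h1, ← h3]
  obtain ⟨d, hd⟩ := Nat.exists_eq_add_of_le h2
  have h4 : Fintype.card β - σ.cycleType.sum = d := by omega
  rw [h4, hd, show ∀ a b c : ℕ, a + b + (c + b) = (a + c) + 2 * b from fun a b c => by ring,
    pow_add _ _ (2 * d), pow_mul]
  simp

end Cycles

/-! ### Halves of premaps -/

section Halves

variable {ι : Type*}

@[simp] theorem signFlip_apply (ε : ι → ℤˣ) (x : ι × ℤˣ) :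
    signFlip ε x = (x.1, ε x.1 * x.2) := rfl

@[simp] theorem delta_apply (x : ι × ℤˣ) : delta ι x = (x.1, -x.2) := by
  simp [delta]

@[simp] theorem delta_mul_self : delta ι * delta ι = 1 := by
  ext x <;> simp

theorem delta_delta (x : ι × ℤˣ) : delta ι (delta ι x) = x := by simp

theorem delta_inv : (delta ι)⁻¹ = delta ι := inv_eq_of_mul_eq_one_left delta_mul_self

@[simp] theorem signFlip_mul_self (ε : ι → ℤˣ) : signFlip ε * signFlip ε = 1 := by
  ext x <;> simp [← mul_assoc]

theorem signFlip_inv (ε : ι → ℤˣ) : (signFlip ε)⁻¹ = signFlip ε :=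
  inv_eq_of_mul_eq_one_left (signFlip_mul_self ε)

theorem signFlip_mul_delta (ε : ι → ℤˣ) : signFlip ε * delta ι = delta ι * signFlip ε := by
  ext x <;> simp

@[simp] theorem posPerm_apply_one (φ : Equiv.Perm ι) (k : ι) : posPerm φ (k, 1) = (φ k, 1) := rfl

theorem neg_one_ne_one : (-1 : ℤˣ) ≠ 1 := by decide

@[simp] theorem posPerm_apply_neg_one (φ : Equiv.Perm ι) (k : ι) :
    posPerm φ (k, -1) = (k, -1) := by
  simp [posPerm]

@[simp] theorem posPerm_apply_snd (φ : Equiv.Perm ι) (x : ι × ℤˣ) :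
    (posPerm φ x).2 = x.2 := rfl

/-- A set of signed indices that is invariant under `π` and contains exactly one of `k`, `-k`
for every `k`. -/
structure IsHalf (π : Equiv.Perm (ι × ℤˣ)) (F : Finset (ι × ℤˣ)) : Prop where
  apply_mem : ∀ x, π x ∈ F ↔ x ∈ F
  delta_mem : ∀ x, delta ι x ∈ F ↔ x ∉ F

variable {π : Equiv.Perm (ι × ℤˣ)} {F : Finset (ι × ℤˣ)}

theorem IsHalf.inv (h : IsHalf π F) : IsHalf π⁻¹ F :=
  ⟨fun x => by rw [← h.apply_mem, ← Equiv.Perm.mul_apply, mul_inv_cancel, Equiv.Perm.one_apply],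
    h.delta_mem⟩

theorem IsHalf.neg_mem (h : IsHalf π F) (k : ι) : (k, -1) ∈ F ↔ (k, 1) ∉ F := by
  simpa using h.delta_mem (k, 1)

theorem IsPremap.delta_mul (hπ : IsPremap π) : delta ι * π = π⁻¹ * delta ι := by
  rw [← hπ.1, mul_assoc, delta_mul_self, mul_one]

theorem IsPremap.inv (hπ : IsPremap π) : IsPremap π⁻¹ :=
  ⟨by rw [← hπ.1, ← mul_assoc, ← mul_assoc, delta_mul_self, one_mul, mul_assoc, delta_mul_self,
      mul_one, hπ.1, inv_inv],
    fun k hk => hπ.2 k hk.of_inv⟩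

theorem IsPremap.delta_apply_apply (hπ : IsPremap π) (x : ι × ℤˣ) :
    delta ι (π x) = π⁻¹ (delta ι x) := by
  rw [← Equiv.Perm.mul_apply, hπ.delta_mul, Equiv.Perm.mul_apply]

/-- The involution `δπ` attached to a premap. -/
theorem IsPremap.delta_apply_delta_apply (hπ : IsPremap π) (x : ι × ℤˣ) :
    delta ι (π (delta ι (π x))) = x := by
  have := hπ.delta_apply_apply (delta ι (π x))
  rw [this, delta_delta, ← Equiv.Perm.mul_apply, inv_mul_cancel, Equiv.Perm.one_apply]

theorem IsPremap.sameCycle_delta_iff (hπ : IsPremap π) (x y : ι × ℤˣ) :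
    π.SameCycle (delta ι x) (delta ι y) ↔ π.SameCycle x y := by
  rw [← Equiv.Perm.sameCycle_inv (f := π) (x := delta ι x)]
  exact (sameCycle_iff_of_semiconj (delta ι).injective hπ.delta_apply_apply x y).symm

/-- The cycles of `x` and `δx` have the same absolute values, hence the same minimum m. Each
contains m or -m, and a cycle containing both would violate the premap condition. -/
theorem IsPremap.isHalf_FD [Fintype ι] [LinearOrder ι] (hπ : IsPremap π) : IsHalf π (FD π) := by
  classical
  refine ⟨apply_mem_FD π, fun x => ?_⟩
  simp only [FD, Finset.mem_filter, Finset.mem_univ, true_and]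
  obtain ⟨z, hz, hmin⟩ := Finset.exists_min_image
    (Finset.univ.filter fun z => π.SameCycle x z) Prod.fst
    ⟨x, by simpa using Equiv.Perm.SameCycle.refl π x⟩
  simp only [Finset.mem_filter, Finset.mem_univ, true_and] at hz hmin
  have hd : ∀ j, π.SameCycle (delta ι x) j ↔ π.SameCycle x (delta ι j) := fun j => by
    rw [← hπ.sameCycle_delta_iff x, delta_delta]
  have hmind : ∀ j, π.SameCycle (delta ι x) j → z.1 ≤ j.1 := fun j hj => by
    simpa using hmin _ ((hd j).1 hj)
  constructor
  · rintro ⟨m, hm, hm'⟩ ⟨l, hl, hl'⟩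
    have h1 : m = z.1 := le_antisymm
      (by simpa using hm' (delta ι z) ((hd _).2 (by rwa [delta_delta]))) (hmind _ hm)
    have h2 : l = z.1 := le_antisymm (hl' _ hz) (hmin _ hl)
    obtain rfl : m = l := h1.trans h2.symm
    exact hπ.2 _ (hl.symm.trans ((hd _).1 hm))
  · intro h
    refine ⟨z.1, ?_, hmind⟩
    rcases Int.units_eq_one_or z.2 with hs | hs
    · exact absurd ⟨z.1, by rwa [← hs], hmin⟩ h
    · rw [hd]
      simpa [← hs] using hz

open Equiv.Perm in
/-- The cycles of a premap come in pairs, one of each pair in a given half. -/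
theorem IsPremap.numCycles_eq [Finite ι] (hπ : IsPremap π) (h : IsHalf π F) :
    numCycles π = 2 * numCycles (π.subtypePerm h.apply_mem) := by
  set κ := π.subtypePerm h.apply_mem
  -- Two copies of `F`, the second embedded by δ; there π acts as the inverse of its restriction to
  -- `F`.
  let e : (Σ _ : ℤˣ, F) → ι × ℤˣ := fun p => if p.1 = 1 then p.2.1 else delta ι p.2.1
  have he : Function.Bijective e := by
    constructor
    · rintro ⟨s, x, hx⟩ ⟨t, y, hy⟩ hxy
      have hne := neg_one_ne_one
      rcases Int.units_eq_one_or s with rfl | rfl <;> rcases Int.units_eq_one_or t with rfl | rfl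
      · simp only [e, if_true] at hxy; subst hxy; rfl
      · simp only [e, if_true, hne, if_false] at hxy
        exact absurd hy ((h.delta_mem y).1 (hxy ▸ hx))
      · simp only [e, if_true, hne, if_false] at hxy
        exact absurd hx ((h.delta_mem x).1 (hxy ▸ hy))
      · simp only [e, hne, if_false, (delta ι).injective.eq_iff] at hxy; subst hxy; rfl
    · intro x
      by_cases hx : x ∈ F
      · exact ⟨⟨1, x, hx⟩, by simp [e]⟩
      · exact ⟨⟨-1, delta ι x, (h.delta_mem x).2 hx⟩, by simp [e]⟩
  have := numCycles_eq_sum_of_sigma (π := fun s : ℤˣ => if s = 1 then κ else κ⁻¹) (σ := π)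
    (Equiv.ofBijective e he) (by
      rintro s ⟨x, hx⟩
      rcases Int.units_eq_one_or s with rfl | rfl
      · simp [e, κ]
      · simp only [Equiv.ofBijective_apply, e, neg_one_ne_one, if_false]
        have := hπ.inv.delta_apply_apply x
        rw [inv_inv] at this
        exact this)
  rw [this, show (Finset.univ : Finset ℤˣ) = {1, -1} from rfl,
    Finset.sum_pair neg_one_ne_one.symm]
  simp only [if_true, neg_one_ne_one, if_false, numCycles_inv]
  ring

end Halves

/-! ### Vertex permutations, sign conjugates and face permutations as premaps -/

section Premaps

variable {ι : Type*}

/-- If δx = π^m x, moving both ends towards the middle of the path gives a point y with δy = y (m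
even) or δy = πy (m odd). The first never happens, so only the second needs excluding. -/
theorem isPremap_of_apply_ne {π : Equiv.Perm (ι × ℤˣ)} (h : delta ι * π * delta ι = π⁻¹)
    (hne : ∀ x, π x ≠ delta ι x) : IsPremap π := by
  have hd : ∀ x, x ≠ delta ι x := fun x hx => by
    have := congrArg Prod.snd hx
    rcases Int.units_eq_one_or x.2 with h1 | h1 <;> simp [h1] at this
  have hconj : ∀ (m : ℤ) x, delta ι ((π ^ m) x) = (π ^ (-m)) (delta ι x) := fun m x => by
    have : delta ι * π ^ m = π ^ (-m) * delta ι := by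
      have h' : π⁻¹ = delta ι * π * (delta ι)⁻¹ := by rw [delta_inv, h]
      rw [← inv_zpow', h', conj_zpow, inv_mul_cancel_right]
    rw [← Equiv.Perm.mul_apply, this, Equiv.Perm.mul_apply]
  refine ⟨h, ?_⟩
  rintro x ⟨m, hm⟩
  rcases Int.even_or_odd' m with ⟨j, rfl | rfl⟩
  · refine hd ((π ^ j) x) ?_
    rw [hconj, ← hm, ← Equiv.Perm.mul_apply, ← zpow_add]
    congr 2; ring
  · refine hne ((π ^ j) x) ?_
    rw [hconj, ← hm, ← Equiv.Perm.mul_apply, ← zpow_one_add, ← Equiv.Perm.mul_apply, ← zpow_add]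
    congr 2; ring

theorem IsPremap.apply_ne_delta {π : Equiv.Perm (ι × ℤˣ)} (h : IsPremap π) (x : ι × ℤˣ) :
    π x ≠ delta ι x := fun hx => h.2 x ⟨1, by simpa using hx⟩

theorem delta_mul_negPerm (φ : Equiv.Perm ι) : delta ι * negPerm φ = posPerm φ * delta ι := by
  rw [negPerm, ← mul_assoc, ← mul_assoc, delta_mul_self, one_mul]

theorem negPerm_inv (φ : Equiv.Perm ι) :
    (negPerm φ)⁻¹ = delta ι * (posPerm φ)⁻¹ * delta ι := by
  rw [negPerm, mul_inv_rev, mul_inv_rev, delta_inv, mul_assoc]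

theorem IsPremap.vertexPerm {α : Equiv.Perm (ι × ℤˣ)} (hα : IsPremap α) (φ : Equiv.Perm ι) :
    IsPremap (vertexPerm φ α) := by
  refine isPremap_of_apply_ne ?_ fun x hx => ?_
  · rw [QuatExpansion.vertexPerm, mul_inv_rev, mul_inv_rev, inv_inv, inv_inv, negPerm_inv, ← hα.1]
    simp only [negPerm, mul_assoc, delta_mul_self, mul_one]
    rw [← mul_assoc (delta ι) (delta ι), delta_mul_self, one_mul]
  · refine hα.inv.apply_ne_delta (negPerm φ x) ?_
    have := congrArg (posPerm φ) hx
    rw [QuatExpansion.vertexPerm] at this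
    simp only [← Equiv.Perm.mul_apply, ← mul_assoc, mul_inv_cancel, one_mul] at this
    rwa [← delta_mul_negPerm] at this

theorem IsPremap.conj_signFlip {α : Equiv.Perm (ι × ℤˣ)} (hα : IsPremap α) (ε : ι → ℤˣ) :
    IsPremap (signFlip ε * α * signFlip ε) := by
  have hcomm : ∀ x, signFlip ε (delta ι x) = delta ι (signFlip ε x) := fun x => by
    rw [← Equiv.Perm.mul_apply, signFlip_mul_delta]
    rfl
  refine isPremap_of_apply_ne ?_ fun x hx => ?_
  · rw [mul_inv_rev, mul_inv_rev, signFlip_inv, ← hα.1]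
    simp only [← mul_assoc, ← signFlip_mul_delta]
    simp only [mul_assoc, ← signFlip_mul_delta]
  · refine hα.apply_ne_delta (signFlip ε x) ?_
    have := congrArg (signFlip ε) hx
    rw [hcomm] at this
    rw [← this, ← Equiv.Perm.mul_apply, ← Equiv.Perm.mul_apply, ← mul_assoc, ← mul_assoc,
      signFlip_mul_self, one_mul]

@[simp] theorem posPerm_symm_apply_neg_one (φ : Equiv.Perm ι) (k : ι) :
    (posPerm φ).symm (k, -1) = (k, -1) := by
  rw [Equiv.symm_apply_eq, posPerm_apply_neg_one]

@[simp] theorem posPerm_symm_apply_one (φ : Equiv.Perm ι) (k : ι) :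
    (posPerm φ).symm (k, 1) = (φ.symm k, 1) := rfl

@[simp] theorem posPerm_symm_apply_snd (φ : Equiv.Perm ι) (x : ι × ℤˣ) :
    ((posPerm φ).symm x).2 = x.2 := rfl

@[simp] theorem facePremap_apply_one (φ : Equiv.Perm ι) (k : ι) :
    facePremap φ (k, 1) = (φ k, 1) := by
  simp [facePremap, negPerm_inv]

@[simp] theorem facePremap_apply_neg_one (φ : Equiv.Perm ι) (k : ι) :
    facePremap φ (k, -1) = (φ.symm k, -1) := by
  simp [facePremap, negPerm_inv]

theorem facePremap_apply_snd (φ : Equiv.Perm ι) (x : ι × ℤˣ) :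
    (facePremap φ x).2 = x.2 := by
  simp [facePremap, negPerm_inv]

theorem isPremap_facePremap (φ : Equiv.Perm ι) : IsPremap (facePremap φ) := by
  refine isPremap_of_apply_ne ?_ fun x hx => ?_
  · simp [facePremap, negPerm, mul_inv_rev, mul_assoc, delta_inv]
  · have h2 := facePremap_apply_snd φ x
    rw [hx] at h2
    rcases Int.units_eq_one_or x.2 with h1 | h1 <;> simp [h1] at h2

/-- Signs are constant along the cycles, so `FD` contains only positive elements; being a half, it
contains all of them. -/
theorem mem_FD_facePremap [Fintype ι] [LinearOrder ι] (φ : Equiv.Perm ι) (x : ι × ℤˣ) :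
    x ∈ FD (facePremap φ) ↔ x.2 = 1 := by
  have h2 : ∀ x, x ∈ FD (facePremap φ) → x.2 = 1 := fun x hx => by
    simp only [FD, Finset.mem_filter, Finset.mem_univ, true_and] at hx
    obtain ⟨m, hm, -⟩ := hx
    exact apply_eq_of_sameCycle (g := Prod.snd) (facePremap_apply_snd φ) hm
  refine ⟨h2 x, fun hx => ?_⟩
  by_contra hmem
  have := h2 _ (((isPremap_facePremap φ).isHalf_FD.delta_mem x).2 hmem)
  rw [delta_apply, hx] at this
  exact neg_one_ne_one this

theorem numCycles_facePremap [Fintype ι] [LinearOrder ι] (φ : Equiv.Perm ι) :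
    numCycles (facePremap φ) = 2 * numCycles φ := by
  have h := isPremap_facePremap φ
  rw [h.numCycles_eq h.isHalf_FD]
  congr 1
  let e : ι ≃ FD (facePremap φ) :=
    { toFun := fun k => ⟨(k, 1), (mem_FD_facePremap φ _).2 rfl⟩
      invFun := fun x => x.1.1
      left_inv := fun k => rfl
      right_inv := fun x => by
        have := (mem_FD_facePremap φ _).1 x.2
        ext <;> simp [this] }
  exact (numCycles_eq_of_semiconj e fun k => Subtype.ext (by simp [e])).symm

end Premaps

/-! ### Transport from the vertex permutation to the premap -/

section DualSign

variable {ι : Type*} {β : Equiv.Perm (ι × ℤˣ)}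

/-- The function on signed indices through which the dual matrices see `v`. -/
def dualSign (φ : Equiv.Perm ι) (v : ι × ℤˣ → ℤˣ) (x : ι × ℤˣ) : ℤˣ :=
  -v (posPerm φ (delta ι x))

/-- Equivalently, φ₊δ conjugates the involution δK into δβ; this duality is behind the whole change
of variables. -/
theorem delta_vertexPerm (hβ : IsPremap β) (φ : Equiv.Perm ι) (x : ι × ℤˣ) :
    posPerm φ (vertexPerm φ β x) = delta ι (β (posPerm φ (delta ι x))) := by
  rw [hβ.delta_apply_apply, ← Equiv.Perm.mul_apply (delta ι), ← Equiv.Perm.mul_apply (posPerm φ),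
    vertexPerm]
  simp only [← Equiv.Perm.mul_apply, ← mul_assoc, mul_inv_cancel, one_mul, negPerm]

theorem dualSign_alternating (hβ : IsPremap β) (φ : Equiv.Perm ι) {v : ι × ℤˣ → ℤˣ}
    (hv : ∀ x, v (delta ι (β x)) = -v x) (x : ι × ℤˣ) :
    dualSign φ v (delta ι (vertexPerm φ β x)) = -dualSign φ v x := by
  rw [dualSign, dualSign, delta_delta, delta_vertexPerm hβ, hv]

end DualSign

section HalfSign

variable {ι : Type*} [DecidableEq ι]

variable {β : Equiv.Perm (ι × ℤˣ)} {F : Finset (ι × ℤˣ)}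

/-- The sign with which the index `k` occurs in a half. -/
def halfSign (F : Finset (ι × ℤˣ)) (k : ι) : ℤˣ := if (k, 1) ∈ F then 1 else -1

theorem IsHalf.halfSign_mem (h : IsHalf β F) (k : ι) : (k, halfSign F k) ∈ F := by
  unfold halfSign
  split_ifs with hk
  · exact hk
  · exact (h.neg_mem k).2 hk

theorem IsHalf.halfSign_eq (h : IsHalf β F) {x : ι × ℤˣ} (hx : x ∈ F) : halfSign F x.1 = x.2 := by
  obtain ⟨k, s⟩ := x
  unfold halfSign
  rcases Int.units_eq_one_or s with rfl | rfl
  · simp [hx]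
  · simp [(h.neg_mem k).1 hx]

end HalfSign

/-! ### Signs of permutations attached to halves -/

section Signs

variable {ι : Type*} [Fintype ι] [DecidableEq ι]

open Equiv.Perm

theorem sign_signFlip (ε : ι → ℤˣ) : sign (signFlip ε) = ∏ k, ε k := by
  have h : signFlip ε = Equiv.prodCongrRight fun k => Equiv.mulLeft (ε k) := by
    ext x <;> simp
  have h2 : ∀ u : ℤˣ, sign (Equiv.mulLeft u) = u := by decide
  rw [h, sign_prodCongrRight]
  simp [h2]

theorem sign_posPerm (φ : Equiv.Perm ι) : sign (posPerm φ) = sign φ := by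
  have h : posPerm φ = Equiv.prodCongrLeft fun s : ℤˣ => if s = 1 then φ else 1 := by
    ext ⟨k, s⟩
    · rcases Int.units_eq_one_or s with rfl | rfl <;> simp
    · simp
  rw [h, sign_prodCongrLeft, show (Finset.univ : Finset ℤˣ) = {1, -1} from rfl,
    Finset.prod_pair neg_one_ne_one.symm]
  simp

/-- A permutation that commutes with `δ` and preserves signs is even. -/
theorem sign_eq_one_of_commute_delta {ψ : Equiv.Perm (ι × ℤˣ)}
    (h : ∀ x, ψ (delta ι x) = delta ι (ψ x)) (hs : ∀ x, (ψ x).2 = x.2) : sign ψ = 1 := by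
  let g : ι → ι := fun k => (ψ (k, 1)).1
  have hg1 : ∀ k, ψ (k, 1) = (g k, 1) := fun k => Prod.ext rfl (hs _)
  have hg2 : ∀ k, ψ (k, -1) = (g k, -1) := fun k => by
    have := h (k, 1)
    rwa [hg1, delta_apply, delta_apply] at this
  have hinj : Function.Injective g := fun k l hkl => by
    have : ψ (k, 1) = ψ (l, 1) := by rw [hg1, hg1, hkl]
    simpa using this
  -- The same permutation acts on the positive and on the negative copy, so the sign is a square.
  have : ψ = Equiv.prodCongrLeft fun _ : ℤˣ =>
      Equiv.ofBijective g (Finite.injective_iff_bijective.1 hinj) := by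
    apply Equiv.ext
    rintro ⟨k, s⟩
    rcases Int.units_eq_one_or s with rfl | rfl
    · rw [hg1]; rfl
    · rw [hg2]; rfl
  rw [this, sign_prodCongrLeft]
  simp

variable {β : Equiv.Perm (ι × ℤˣ)} {F : Finset (ι × ℤˣ)}

theorem IsHalf.prod_eq {M : Type*} [CommMonoid M] (h : IsHalf β F) (g : ι × ℤˣ → M) :
    ∏ x ∈ F, g x = ∏ k, g (k, halfSign F k) := by
  refine Finset.prod_bij' (fun x _ => x.1) (fun k _ => (k, halfSign F k)) ?_ ?_ ?_ ?_ ?_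
  · simp
  · exact fun k _ => h.halfSign_mem k
  · exact fun x hx => by simp [h.halfSign_eq hx]
  · simp
  · exact fun x hx => by simp [h.halfSign_eq hx]

theorem IsHalf.card_eq (h : IsHalf β F) : F.card = Fintype.card ι := by
  have : ∑ x ∈ F, 1 = ∑ k : ι, 1 :=
    Multiplicative.ofAdd.injective (h.prod_eq fun _ => Multiplicative.ofAdd 1)
  simpa using this

/-- For a function `v` alternating along the involution `δβ`, the sign of the permutations that
take `δ` to `δβ` and the positive indices to the indices where `v` is `1`. -/
theorem IsPremap.exists_sign_eq (hβ : IsPremap β) (h : IsHalf β F) {v : ι × ℤˣ → ℤˣ}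
    (hv : ∀ x, v (delta ι (β x)) = -v x) :
    ∃ σ : Equiv.Perm (ι × ℤˣ), (∀ x, σ (delta ι x) = delta ι (β (σ x))) ∧
      (∀ k, v (σ (k, 1)) = 1) ∧
      sign σ = (∏ x ∈ F, x.2) * sign (β.subtypePerm h.apply_mem) * ∏ x ∈ F, v x := by
  have hinv : ∀ x, x ∉ F ↔ β⁻¹ x ∉ F := fun x => not_congr (h.inv.apply_mem x).symm
  -- Identity on `F` and β⁻¹ off `F`, so that κ takes each pair {x, δx} with x in `F` to {x, δβx}.
  let κ : Equiv.Perm (ι × ℤˣ) :=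
    ofSubtype (β⁻¹.subtypePerm (p := fun x => x ∉ F) fun x => (hinv x).symm)
  have hκ1 : ∀ x ∈ F, κ x = x := fun x hx => by
    simp only [κ]
    exact ofSubtype_apply_of_not_mem _ (by simpa using hx)
  have hκ2 : ∀ x, x ∉ F → κ x = β⁻¹ x := fun x hx => by
    simp only [κ]
    exact ofSubtype_apply_of_mem (p := fun x => x ∉ F) _ hx
  have hκ : sign κ = sign (β.subtypePerm h.apply_mem) := by
    simp only [κ, sign_ofSubtype]
    -- δ conjugates β on `F` into β⁻¹ on the complement.
    let e : F ≃ {x // x ∉ F} :=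
      { toFun := fun x => ⟨delta ι x, fun hx => (h.delta_mem _).1 hx x.2⟩
        invFun := fun x => ⟨delta ι x, (h.delta_mem _).2 x.2⟩
        left_inv := fun x => Subtype.ext (delta_delta _)
        right_inv := fun x => Subtype.ext (delta_delta _) }
    refine (sign_eq_sign_of_equiv _ _ e fun x => Subtype.ext ?_).symm
    exact hβ.delta_apply_apply x
  -- `τ` already takes δ to δβ. Flipping the pairs on which v is -1 at the element of `F` makes v
  -- equal to 1 on the images of positive indices.
  let u : ι → ℤˣ := fun k => v (k, halfSign F k)
  let τ : Equiv.Perm (ι × ℤˣ) := κ * signFlip (halfSign F)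
  have hτ1 : ∀ k, τ (k, 1) = (k, halfSign F k) := fun k => by
    simp only [τ, Equiv.Perm.mul_apply, signFlip_apply, mul_one]
    exact hκ1 _ (h.halfSign_mem k)
  have hτ2 : ∀ k, τ (k, -1) = delta ι (β (k, halfSign F k)) := fun k => by
    have h1 : (k, halfSign F k * -1) = delta ι (k, halfSign F k) := by simp
    simp only [τ, Equiv.Perm.mul_apply, signFlip_apply]
    rw [hβ.delta_apply_apply, ← h1]
    exact hκ2 _ (by rw [h1, h.delta_mem, not_not]; exact h.halfSign_mem k)
  have hτδ : ∀ x, τ (delta ι x) = delta ι (β (τ x)) := by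
    rintro ⟨k, s⟩
    rcases Int.units_eq_one_or s with rfl | rfl
    · rw [hτ1, ← hτ2, delta_apply]
    · rw [hτ2, hβ.delta_apply_delta_apply, ← hτ1, delta_apply, neg_neg]
  have hvτ : ∀ k s, v (τ (k, s)) = s * u k := fun k s => by
    rcases Int.units_eq_one_or s with rfl | rfl
    · rw [hτ1, one_mul]
    · rw [hτ2, hv, neg_one_mul]
  refine ⟨τ * signFlip u, fun x => ?_, fun k => ?_, ?_⟩
  · rw [Equiv.Perm.mul_apply τ, Equiv.Perm.mul_apply τ, ← hτδ,
      ← Equiv.Perm.mul_apply (signFlip u), signFlip_mul_delta]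
    rfl
  · rw [Equiv.Perm.mul_apply, signFlip_apply, hvτ, mul_one, Int.units_mul_self]
  · rw [Equiv.Perm.sign_mul, Equiv.Perm.sign_mul, sign_signFlip, sign_signFlip, hκ, h.prod_eq, h.prod_eq]
    simp only [u]
    rw [mul_comm (sign _) (∏ k, halfSign F k)]

/-- The sign of such a permutation depends on `β` and `v` alone. -/
theorem sign_eq_sign_of_alternating {v : ι × ℤˣ → ℤˣ} (hv : ∀ x, v (delta ι (β x)) = -v x)
    {σ τ : Equiv.Perm (ι × ℤˣ)} (hσ : ∀ x, σ (delta ι x) = delta ι (β (σ x)))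
    (hτ : ∀ x, τ (delta ι x) = delta ι (β (τ x))) (hvσ : ∀ k, v (σ (k, 1)) = 1)
    (hvτ : ∀ k, v (τ (k, 1)) = 1) : sign σ = sign τ := by
  have key : ∀ {ρ : Equiv.Perm (ι × ℤˣ)}, (∀ x, ρ (delta ι x) = delta ι (β (ρ x))) →
      (∀ k, v (ρ (k, 1)) = 1) → ∀ x, v (ρ x) = x.2 := by
    rintro ρ hρ hvρ ⟨k, s⟩
    rcases Int.units_eq_one_or s with rfl | rfl
    · exact hvρ k
    · have : ((k, -1) : ι × ℤˣ) = delta ι (k, 1) := by simp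
      rw [this, hρ, hv, hvρ, delta_apply]
  -- Both permutations turn v into the sign of the index, so their quotient preserves signs and
  -- commutes with δ.
  have h1 : sign (σ⁻¹ * τ) = 1 := by
    refine sign_eq_one_of_commute_delta (fun x => ?_) fun x => ?_
    · rw [Equiv.Perm.mul_apply, inv_eq_iff_eq, hτ, hσ, Equiv.Perm.mul_apply,
        ← Equiv.Perm.mul_apply σ, mul_inv_cancel, Equiv.Perm.one_apply]
    · rw [← key hσ hvσ, ← key hτ hvτ, ← Equiv.Perm.mul_apply, mul_inv_cancel_left]
  rw [Equiv.Perm.sign_mul, sign_inv] at h1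
  have := congrArg (sign σ * ·) h1
  simpa [← mul_assoc] using this.symm

theorem sign_subtypePerm_eq (hβ : IsPremap β) (h : IsHalf β F) :
    sign (β.subtypePerm h.apply_mem) = (-1) ^ (Fintype.card ι + numCycles β / 2) := by
  rw [sign_eq_neg_one_pow_card_add_numCycles, hβ.numCycles_eq h, Fintype.card_coe, h.card_eq]
  simp

/-- The comparison of the signs attached to a premap and to its vertex permutation. -/
theorem prod_mul_prod_dualSign (hβ : IsPremap β) (h : IsHalf β F) (φ : Equiv.Perm ι)
    {G : Finset (ι × ℤˣ)} (hG : IsHalf (vertexPerm φ β) G) {v : ι × ℤˣ → ℤˣ}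
    (hv : ∀ x, v (delta ι (β x)) = -v x) :
    ((∏ x ∈ F, x.2) * ∏ x ∈ F, v x) * ((∏ x ∈ G, x.2) * ∏ x ∈ G, dualSign φ v x) =
      (-1) ^ (Fintype.card ι + numCycles φ + numCycles β / 2
        + numCycles (vertexPerm φ β) / 2) := by
  obtain ⟨σ, hσ, hvσ, hsσ⟩ := hβ.exists_sign_eq h hv
  obtain ⟨τ, hτ, hvτ, hsτ⟩ := (hβ.vertexPerm φ).exists_sign_eq hG (dualSign_alternating hβ φ hv)
  -- φ₊δτ takes δ to δβ, but by the minus sign in `dualSign` it sends positive indices to v = -1;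
  -- the last δ repairs this. The two δ's cancel in the sign.
  have hρ : ∀ x, (posPerm φ * delta ι * τ * delta ι) (delta ι x)
      = delta ι (β ((posPerm φ * delta ι * τ * delta ι) x)) := fun x => by
    simp only [Equiv.Perm.mul_apply]
    rw [hτ (delta ι x), delta_delta, delta_vertexPerm hβ]
  have hvρ : ∀ k, v ((posPerm φ * delta ι * τ * delta ι) (k, 1)) = 1 := fun k => by
    have h1 := hτ (k, 1)
    have h2 := hvτ k
    simp only [Equiv.Perm.mul_apply]
    rw [h1, delta_delta, delta_vertexPerm hβ, hv]
    exact h2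
  have := sign_eq_sign_of_alternating hv hσ hρ hvσ hvρ
  rw [hsσ, Equiv.Perm.sign_mul, Equiv.Perm.sign_mul, Equiv.Perm.sign_mul, sign_posPerm, hsτ, sign_subtypePerm_eq hβ h,
    sign_subtypePerm_eq (hβ.vertexPerm φ) hG, sign_eq_neg_one_pow_card_add_numCycles φ] at this
  have hδ := Int.units_mul_self (sign (delta ι))
  have hc := Int.units_mul_self (∏ x ∈ G, x.2)
  have hd := Int.units_mul_self (∏ x ∈ G, dualSign φ v x)
  have h1 : ((-1 : ℤˣ) ^ (Fintype.card ι + numCycles β / 2))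
      * (-1) ^ (Fintype.card ι + numCycles β / 2) = 1 := Int.units_mul_self _
  have h2 : ((-1 : ℤˣ) ^ Fintype.card ι) * (-1) ^ Fintype.card ι = 1 := Int.units_mul_self _
  generalize ∏ x ∈ F, x.2 = a at *
  generalize ∏ x ∈ F, v x = b at *
  generalize ∏ x ∈ G, x.2 = c at *
  generalize ∏ x ∈ G, dualSign φ v x = d at *
  generalize sign (delta ι) = e at *
  simp only [pow_add] at *
  generalize (-1 : ℤˣ) ^ Fintype.card ι = m at *
  generalize (-1 : ℤˣ) ^ (numCycles β / 2) = p at *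
  generalize (-1 : ℤˣ) ^ (numCycles (vertexPerm φ β) / 2) = q at *
  generalize (-1 : ℤˣ) ^ numCycles φ = r at *
  calc a * b * (c * d) = a * b * (c * d) * (m * p * (m * p)) := by rw [h1, mul_one]
    _ = (a * (m * p) * b) * (m * p * c * d) := by ac_rfl
    _ = m * r * p * q * ((m * m) * (e * e) * (c * c) * (d * d)) := by rw [this]; ac_rfl
    _ = m * r * p * q := by rw [h2, hδ, hc, hd]; simp

end Signs

/-! ### Entries of quaternionic matrices -/

section Entries

theorem sum_signs {M : Type*} [AddCommMonoid M] (g : ℤˣ → M) : ∑ s, g s = g 1 + g (-1) := by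
  rw [show (Finset.univ : Finset ℤˣ) = {1, -1} from rfl, Finset.sum_pair neg_one_ne_one.symm]

theorem quatMatrix_mul (p q : Quaternion ℝ) :
    quatMatrix (p * q) = quatMatrix p * quatMatrix q := by
  ext η θ
  rw [Matrix.mul_apply, sum_signs]
  rcases Int.units_eq_one_or η with rfl | rfl <;> rcases Int.units_eq_one_or θ with rfl | rfl <;>
    apply Complex.ext <;> simp [quatMatrix] <;> ring

theorem quatMatrix_add (p q : Quaternion ℝ) (η θ : ℤˣ) :
    quatMatrix (p + q) η θ = quatMatrix p η θ + quatMatrix q η θ := by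
  rcases Int.units_eq_one_or η with rfl | rfl <;> rcases Int.units_eq_one_or θ with rfl | rfl <;>
    apply Complex.ext <;> simp [quatMatrix] <;> ring

theorem quatMatrix_sum {κ : Type*} (s : Finset κ) (q : κ → Quaternion ℝ) (η θ : ℤˣ) :
    quatMatrix (∑ j ∈ s, q j) η θ = ∑ j ∈ s, quatMatrix (q j) η θ :=
  map_sum (AddMonoidHom.mk' (fun q => quatMatrix q η θ) fun p q => quatMatrix_add p q η θ) q s

/-- The adjoint transposes and conjugates, and conjugating the (θ, η) entry gives ηθ times the (-θ,
-η) entry. -/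
theorem quatMatrix_star (q : Quaternion ℝ) (η θ : ℤˣ) :
    quatMatrix (star q) η θ = (((η * θ : ℤˣ) : ℤ) : ℂ) * quatMatrix q (-θ) (-η) := by
  rcases Int.units_eq_one_or η with rfl | rfl <;> rcases Int.units_eq_one_or θ with rfl | rfl <;>
    apply Complex.ext <;> simp [quatMatrix]

variable {N : ℕ}

theorem entry_mul (A B : Matrix (Fin N) (Fin N) (Quaternion ℝ)) (i j : Fin N) (η θ : ℤˣ) :
    entry (A * B) i j η θ = ∑ l, ∑ s, entry A i l η s * entry B l j s θ := by
  simp only [entry, Matrix.mul_apply, quatMatrix_sum, quatMatrix_mul]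

/-- The sign picked up by the entry of an adjoint: `η_k η_{-k}` for negative indices. -/
def adjointSign {ι : Type*} (η : ι × ℤˣ → ℤˣ) (x : ι × ℤˣ) : ℤˣ :=
  if x.2 = 1 then 1 else η (x.1, 1) * η (x.1, -1)

/-- The factors `x.2` undo the reversal of both sign indices by the adjoint, so one formula serves
both signs and the entry on the right depends only on |x|. -/
theorem entry_signedMatrix {ι : Type*} (A : ι → Matrix (Fin N) (Fin N) (Quaternion ℝ))
    (i : ι × ℤˣ → Fin N) (η : ι × ℤˣ → ℤˣ) (x : ι × ℤˣ) :
    entry (signedMatrix A x) (i x) (i (delta ι x)) (x.2 * η x) (x.2 * η (delta ι x)) =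
      ((adjointSign η x : ℤ) : ℂ) *
        entry (A x.1) (i (x.1, 1)) (i (x.1, -1)) (η (x.1, 1)) (η (x.1, -1)) := by
  obtain ⟨k, s⟩ := x
  rcases Int.units_eq_one_or s with rfl | rfl
  · simp [signedMatrix, adjointSign]
  · simp only [signedMatrix, adjointSign, delta_apply, neg_one_ne_one, if_false, neg_neg, entry,
      Matrix.conjTranspose_apply, quatMatrix_star, neg_one_mul, neg_mul_neg]
    rw [mul_comm (η (k, -1))]

theorem measurable_entry {Ω : Type*} [MeasurableSpace Ω]
    {A : Ω → Matrix (Fin N) (Fin N) (Quaternion ℝ)} {i j : Fin N}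
    (h : Measurable fun ω => A ω i j) (η θ : ℤˣ) :
    Measurable fun ω => entry (A ω) i j η θ := by
  refine Measurable.comp (g := fun q => quatMatrix q η θ) ?_ h
  have e : ∀ a b : ℝ, (⟨a, b⟩ : ℂ) = (a : ℂ) + b * Complex.I := Complex.mk_eq_add_mul_I
  refine Continuous.measurable ?_
  unfold quatMatrix
  simp only [e]
  have := Quaternion.continuous_re
  have := Quaternion.continuous_imI
  have := Quaternion.continuous_imJ
  have := Quaternion.continuous_imK
  split_ifs <;> fun_prop

end Entries

/-! ### The change of variables between a premap and its vertex permutation -/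

theorem posPerm_delta_vertexPerm_inv {ι : Type*} {β : Equiv.Perm (ι × ℤˣ)} (φ : Equiv.Perm ι) (x : ι × ℤˣ) :
    posPerm φ (delta ι ((vertexPerm φ β)⁻¹ x)) = delta ι (β (posPerm φ x)) := by
  simp only [vertexPerm, mul_inv_rev, inv_inv, negPerm_inv, Equiv.Perm.mul_apply, delta_delta]
  rw [← Equiv.Perm.mul_apply, mul_inv_cancel, Equiv.Perm.one_apply]

section ChangeOfVariables

variable {ι : Type*} [Fintype ι] [DecidableEq ι] {β : Equiv.Perm (ι × ℤˣ)}
  {F : Finset (ι × ℤˣ)}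

/-- The product of all values of an alternating function. -/
theorem prod_alternating (hβ : IsHalf β F) {v : ι × ℤˣ → ℤˣ}
    (hv : ∀ x, v (delta ι (β x)) = -v x) :
    ∏ k, v (k, 1) * v (k, -1) = (-1) ^ Fintype.card ι := by
  -- β permutes `F`, so δβ and δ give the same product over `F`; along δβ each value is negated.
  have h1 : ∏ x ∈ F, v (delta ι (β x)) = ∏ x ∈ F, v (delta ι x) :=
    Finset.prod_equiv β (fun x => (hβ.apply_mem x).symm) fun _ _ => rfl
  have h2 : ∏ x ∈ F, v x * v (delta ι x) = ∏ k, v (k, 1) * v (k, -1) := by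
    rw [hβ.prod_eq]
    refine Finset.prod_congr rfl fun k _ => ?_
    rcases Int.units_eq_one_or (halfSign F k) with h | h <;> simp [h, mul_comm]
  rw [← h2, Finset.prod_mul_distrib, ← h1, ← Finset.prod_mul_distrib]
  simp only [hv, mul_neg, Int.units_mul_self, Finset.prod_const, hβ.card_eq]

/-- Isolates the combination that is the sign of a permutation; the remaining factor does not depend
on the half. -/
theorem prod_adjointSign (hβ : IsHalf β F) (H : ι × ℤˣ → ℤˣ) :
    ∏ x ∈ F, adjointSign H x = (∏ x ∈ F, x.2) * (∏ x ∈ F, x.2 * H x) * ∏ k, H (k, 1) := by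
  have h1 : ∏ k, H (k, 1) = ∏ x ∈ F, H (x.1, 1) := (hβ.prod_eq fun x => H (x.1, 1)).symm
  rw [h1, ← Finset.prod_mul_distrib, ← Finset.prod_mul_distrib]
  refine Finset.prod_congr rfl fun x _ => ?_
  obtain ⟨k, s⟩ := x
  rcases Int.units_eq_one_or s with rfl | rfl
  · simp [adjointSign]
  · simp [adjointSign, mul_comm]

theorem prod_adjointSign_mul_prod_adjointSign (hβ : IsPremap β) (h : IsHalf β F)
    (φ : Equiv.Perm ι) {G : Finset (ι × ℤˣ)} (hG : IsHalf (vertexPerm φ β) G)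
    {H : ι × ℤˣ → ℤˣ} (hH : ∀ x, x.2 * H x = (β x).2 * H (delta ι (β x))) :
    (∏ x ∈ F, adjointSign H x) * ∏ x ∈ G, adjointSign (fun x => H (posPerm φ (delta ι x))) x =
      (-1) ^ (Fintype.card ι + numCycles φ + numCycles β / 2
        + numCycles (vertexPerm φ β) / 2) := by
  set v : ι × ℤˣ → ℤˣ := fun x => x.2 * H x with hvdef
  have hv : ∀ x, v (delta ι (β x)) = -v x := fun x => by
    simp only [hvdef]
    rw [hH x, delta_apply, neg_mul]
  have hd : ∀ x, x.2 * H (posPerm φ (delta ι x)) = dualSign φ v x := fun x => by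
    simp [dualSign, hvdef]
  rw [← prod_mul_prod_dualSign hβ h φ hG hv, prod_adjointSign h, prod_adjointSign hG]
  simp only [hd]
  -- The factors independent of the halves cancel: as v(k)v(-k) = -H(k)H(-k), the product of all
  -- values of `H` is 1.
  have h3 : (∏ k, H (k, 1)) * ∏ k, H (posPerm φ (delta ι (k, 1))) = 1 := by
    have := prod_alternating h hv
    rw [← Finset.prod_mul_distrib]
    simp only [hvdef] at this
    have h4 : ∀ k, (1 * H (k, 1)) * (-1 * H (k, -1)) = -1 * (H (k, 1) * H (k, -1)) :=
      fun k => by simp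
    simp only [h4, Finset.prod_mul_distrib, Finset.prod_const, Finset.card_univ] at this
    have h5 : ∀ k : ι, posPerm φ (delta ι (k, 1)) = (k, -1) := fun k => by simp
    simp only [h5, Finset.prod_mul_distrib]
    exact mul_left_cancel (this.trans (mul_one _).symm)
  rw [mul_mul_mul_comm, h3, mul_one]

/-- A function on a half extends uniquely to a function `g` with `g ∘ π = -g ∘ δ`. -/
theorem sum_half_eq_sum_alternating {M : Type*} [AddCommMonoid M] {π : Equiv.Perm (ι × ℤˣ)}
    (hπ : IsPremap π) {G : Finset (ι × ℤˣ)} (hG : IsHalf π G) (Φ : (G → ℤˣ) → M) :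
    ∑ h, Φ h = ∑ g : ι × ℤˣ → ℤˣ with ∀ x, g (π x) = -g (delta ι x), Φ fun x => g x := by
  symm
  have hmem : ∀ x, x ∉ G → π (delta ι x) ∈ G := fun x hx =>
    (hG.apply_mem _).2 ((hG.delta_mem _).2 hx)
  refine Finset.sum_bij' (fun g _ x => g x)
    -- Off `G` the value is forced by the alternation at δx, which lies in `G`.
    (fun h _ x => if hx : x ∈ G then h ⟨x, hx⟩ else -h ⟨π (delta ι x), hmem x hx⟩)
    (by simp) ?_ ?_ ?_ (by simp)
  · intro h _
    simp only [Finset.mem_filter, Finset.mem_univ, true_and]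
    intro x
    by_cases hx : x ∈ G
    · have h1 : delta ι x ∉ G := by rw [hG.delta_mem]; simpa using hx
      simp only [(hG.apply_mem x).2 hx, dif_pos, dif_neg h1, neg_neg, delta_delta]
    · have h1 : delta ι x ∈ G := (hG.delta_mem x).2 hx
      have h2 : π x ∉ G := by rwa [hG.apply_mem]
      rw [dif_neg h2, dif_pos h1]
      congr 3
      rw [hπ.delta_apply_apply, ← Equiv.Perm.mul_apply, mul_inv_cancel, Equiv.Perm.one_apply]
  · intro g hg
    simp only [Finset.mem_filter, Finset.mem_univ, true_and] at hg
    funext x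
    by_cases hx : x ∈ G
    · simp [hx]
    · simp only [hx, dif_neg, not_false_eq_true]
      rw [hg, delta_delta, neg_neg]
  · intro h _
    funext x
    simp

end ChangeOfVariables

section ChangeOfVariables

variable {ι : Type*} [Fintype ι] [LinearOrder ι] {N : ℕ} {β : Equiv.Perm (ι × ℤˣ)}
  {F : Finset (ι × ℤˣ)}

theorem sum_index_eq {M : Type*} [AddCommMonoid M] (φ : Equiv.Perm ι)
    (Φ : (ι × ℤˣ → Fin N) → M) :
    ∑ i : ι × ℤˣ → Fin N with ∀ k, i ((vertexPerm φ β)⁻¹ k) = i (delta ι k), Φ i =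
      ∑ A : ι × ℤˣ → Fin N with ∀ x, A x = A (delta ι (β x)),
        Φ fun x => A (posPerm φ (delta ι x)) := by
  symm
  refine Finset.sum_equiv
    { toFun := fun A x => A (posPerm φ (delta ι x))
      invFun := fun i y => i (delta ι ((posPerm φ)⁻¹ y))
      left_inv := fun A => by funext y; dsimp only; rw [delta_delta]; simp
      right_inv := fun i => by funext x; simp } (fun A => ?_) fun _ _ => rfl
  simp only [Finset.mem_filter, Finset.mem_univ, true_and, Equiv.coe_fn_mk,
    posPerm_delta_vertexPerm_inv, delta_delta]
  rw [← (posPerm φ).forall_congr_right]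
  exact forall_congr' fun _ => eq_comm

/-- The factor `x.2` in the substitution converts the alternating condition along K⁻¹ into the sign
condition of the moment formula for β. -/
theorem sum_sign_eq {M : Type*} [AddCommMonoid M] (φ : Equiv.Perm ι)
    (Φ : (ι × ℤˣ → ℤˣ) → M) :
    ∑ g : ι × ℤˣ → ℤˣ with ∀ x, g ((vertexPerm φ β)⁻¹ x) = -g (delta ι x), Φ g =
      ∑ H : ι × ℤˣ → ℤˣ with ∀ x, x.2 * H x = (β x).2 * H (delta ι (β x)),
        Φ fun x => x.2 * H (posPerm φ (delta ι x)) := by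
  symm
  refine Finset.sum_equiv
    { toFun := fun H x => x.2 * H (posPerm φ (delta ι x))
      invFun := fun g y => -y.2 * g (delta ι ((posPerm φ)⁻¹ y))
      left_inv := fun H => by
        funext y; dsimp only; rw [delta_delta]; simp [← mul_assoc]
      right_inv := fun i => by funext x; simp [← mul_assoc] } (fun H => ?_) fun _ _ => rfl
  simp only [Finset.mem_filter, Finset.mem_univ, true_and, Equiv.coe_fn_mk,
    posPerm_delta_vertexPerm_inv, delta_delta]
  rw [← (posPerm φ).forall_congr_right]
  refine forall_congr' fun x => ?_
  have := congrArg Prod.snd (posPerm_delta_vertexPerm_inv (β := β) φ x)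
  simp only [posPerm_apply_snd, delta_apply, neg_inj] at this
  rw [this, posPerm_apply_snd, show (delta ι x).2 = -x.2 by simp, neg_mul, neg_neg]
  exact eq_comm

/-- `F` is an arbitrary half because the sign changes by ε move `FD(α)` to a half of β that need not
be `FD(β)`. -/
theorem sum_alternating_eq (hβ : IsPremap β) (hF : IsHalf β F) (φRe φtr : Equiv.Perm ι)
    (Y : ι → Matrix (Fin N) (Fin N) (Quaternion ℝ)) :
    ∑ A : ι × ℤˣ → Fin N with ∀ x, A x = A (delta ι (β x)),
      ∑ H : ι × ℤˣ → ℤˣ with ∀ x, x.2 * H x = (β x).2 * H (delta ι (β x)),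
        (((∏ x ∈ F, adjointSign H x : ℤˣ) : ℤ) : ℂ) *
          ∏ k, entry (Y k) (A (k, -1)) (A (φtr k, 1)) (H (k, -1)) (H (φRe k, 1)) =
    (-1) ^ (Fintype.card ι + numCycles φRe + numCycles β / 2
        + numCycles (vertexPerm φRe β) / 2) *
      ∑ i : ι × ℤˣ → Fin N with ∀ k, i ((vertexPerm φtr β)⁻¹ k) = i (delta ι k),
        ∑ h : FD (vertexPerm φRe β)⁻¹ → ℤˣ, ∏ k : FD (vertexPerm φRe β)⁻¹,
          entry (signedMatrix Y k) (i k) (i ((vertexPerm φtr β)⁻¹ k)) (h k)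
            (h (fdPerm (vertexPerm φRe β)⁻¹ k)) := by
  have hπ := (hβ.vertexPerm φRe).inv
  have hG := hπ.isHalf_FD
  have hG' := hG.inv
  rw [inv_inv] at hG'
  have step : ∀ i : ι × ℤˣ → Fin N, (∀ k, i ((vertexPerm φtr β)⁻¹ k) = i (delta ι k)) →
      ∑ h : FD (vertexPerm φRe β)⁻¹ → ℤˣ, ∏ k : FD (vertexPerm φRe β)⁻¹,
          entry (signedMatrix Y k) (i k) (i ((vertexPerm φtr β)⁻¹ k)) (h k)
            (h (fdPerm (vertexPerm φRe β)⁻¹ k)) =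
      ∑ H : ι × ℤˣ → ℤˣ with ∀ x, x.2 * H x = (β x).2 * H (delta ι (β x)),
        (-1) ^ (Fintype.card ι + numCycles φRe + numCycles β / 2
            + numCycles (vertexPerm φRe β) / 2) *
          ((((∏ x ∈ F, adjointSign H x : ℤˣ) : ℤ) : ℂ) *
            ∏ k, entry (Y k) (i (k, 1)) (i (k, -1)) (H (k, -1)) (H (φRe k, 1))) := by
    intro i hi
    rw [sum_half_eq_sum_alternating hπ hG]
    have h1 : ∀ g ∈ Finset.univ.filter fun g : ι × ℤˣ → ℤˣ =>
        ∀ x, g ((vertexPerm φRe β)⁻¹ x) = -g (delta ι x),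
        ∏ k : FD (vertexPerm φRe β)⁻¹,
          entry (signedMatrix Y k) (i k) (i ((vertexPerm φtr β)⁻¹ k)) (g k)
            (g (fdPerm (vertexPerm φRe β)⁻¹ k)) =
        ∏ k ∈ FD (vertexPerm φRe β)⁻¹,
          entry (signedMatrix Y k) (i k) (i (delta ι k)) (g k) (-g (delta ι k)) := by
      intro g hg
      simp only [Finset.mem_filter, Finset.mem_univ, true_and] at hg
      refine Eq.trans (Finset.prod_congr rfl fun k _ => ?_)
        (Finset.prod_coe_sort (FD (vertexPerm φRe β)⁻¹) fun k =>
          entry (signedMatrix Y k) (i k) (i (delta ι k)) (g k) (-g (delta ι k)))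
      rw [hi, ← hg]
      rfl
    rw [Finset.sum_congr rfl h1, sum_sign_eq]
    refine Finset.sum_congr rfl fun H hH => ?_
    simp only [Finset.mem_filter, Finset.mem_univ, true_and] at hH
    set J : ι × ℤˣ → ℤˣ := fun x => H (posPerm φRe (delta ι x)) with hJ
    -- After the substitution each entry depends only on |x|, so the half `FD(K⁻¹)` survives only in
    -- the adjoint signs.
    have h2 : ∀ x, entry (signedMatrix Y x) (i x) (i (delta ι x)) (x.2 * J x)
        (-((delta ι x).2 * J (delta ι x))) = ((adjointSign J x : ℤ) : ℂ) *
          entry (Y x.1) (i (x.1, 1)) (i (x.1, -1)) (J (x.1, 1)) (J (x.1, -1)) := fun x => by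
      rw [← entry_signedMatrix]
      rw [delta_apply x, neg_mul, neg_neg]
    refine (Finset.prod_congr rfl fun x _ => h2 x).trans ?_
    rw [Finset.prod_mul_distrib,
      hG.prod_eq fun x => entry (Y x.1) (i (x.1, 1)) (i (x.1, -1)) (J (x.1, 1)) (J (x.1, -1))]
    have h3 := prod_adjointSign_mul_prod_adjointSign hβ hF φRe hG' hH
    have h4 : (((∏ x ∈ FD (vertexPerm φRe β)⁻¹, adjointSign J x : ℤˣ) : ℤ) : ℂ) =
        (-1) ^ (Fintype.card ι + numCycles φRe + numCycles β / 2
          + numCycles (vertexPerm φRe β) / 2) * (((∏ x ∈ F, adjointSign H x : ℤˣ) : ℤ) : ℂ) := by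
      have h5 := congrArg ((∏ x ∈ F, adjointSign H x) * ·) h3
      simp only [← mul_assoc, Int.units_mul_self, one_mul] at h5
      rw [h5]
      push_cast
      ring
    rw [← mul_assoc, ← h4]
    push_cast
    congr 1
  have hstep := Finset.sum_congr (rfl : Finset.univ.filter (fun i : ι × ℤˣ → Fin N =>
    ∀ k, i ((vertexPerm φtr β)⁻¹ k) = i (delta ι k)) = _)
    fun i hi => step i (Finset.mem_filter.1 hi).2
  rw [hstep, sum_index_eq, Finset.mul_sum]
  refine Finset.sum_congr rfl fun A _ => ?_
  rw [Finset.mul_sum]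
  refine Finset.sum_congr rfl fun H _ => ?_
  rw [← mul_assoc, ← mul_pow, neg_one_mul, neg_neg, one_pow, one_mul]
  simp

end ChangeOfVariables

/-! ### Products of premaps on colour classes -/

section PremapProd

variable {n C : ℕ} {w : Fin n → Fin C}

theorem extendTrivially_apply (I : Finset (Fin n)) (π : Equiv.Perm (I × ℤˣ)) (x : I × ℤˣ) :
    extendTrivially I π (x.1, x.2) = ((π x).1.1, (π x).2) :=
  Equiv.Perm.extendDomain_apply_image π
    (Equiv.prodSubtypeFstEquivSubtypeProd (p := fun k : Fin n => k ∈ I) (β := ℤˣ)).symm x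

theorem extendTrivially_apply_of_notMem (I : Finset (Fin n)) (π : Equiv.Perm (I × ℤˣ))
    {x : Fin n × ℤˣ} (hx : x.1 ∉ I) : extendTrivially I π x = x :=
  Equiv.Perm.extendDomain_apply_not_subtype π _ hx

theorem mem_colourClass {c : Fin C} {k : Fin n} : k ∈ colourClass w c ↔ w k = c := by
  simp [colourClass]

theorem premapProd_apply (α : ∀ c, PM (colourClass w c)) (c : Fin C)
    (x : colourClass w c × ℤˣ) :
    premapProd α (x.1, x.2) = (((α c).1 x).1.1, ((α c).1 x).2) := by
  set g : Fin C → Equiv.Perm (Fin n × ℤˣ) := fun c => extendTrivially (colourClass w c) (α c).1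
  -- Induction over duplicate-free lists of colours: only the factor of colour `c` moves an index of
  -- that colour.
  have key : ∀ l : List (Fin C), l.Nodup → ∀ y : colourClass w c × ℤˣ,
      (l.map g).prod (y.1, y.2) =
        if c ∈ l then (((α c).1 y).1.1, ((α c).1 y).2) else (y.1.1, y.2) := by
    intro l
    induction l with
    | nil => simp
    | cons d l ih =>
      intro hl y
      rw [List.nodup_cons] at hl
      rw [List.map_cons, List.prod_cons, Equiv.Perm.mul_apply, ih hl.2]
      have hne : ∀ z : colourClass w c × ℤˣ, d ≠ c → g d (z.1, z.2) = (z.1.1, z.2) := by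
        intro z hd
        refine extendTrivially_apply_of_notMem _ _ ?_
        rw [mem_colourClass, mem_colourClass.1 z.1.2]
        exact hd.symm
      by_cases hd : d = c
      · subst hd
        rw [if_neg hl.1, if_pos (by simp)]
        exact extendTrivially_apply _ _ y
      · by_cases hc : c ∈ l
        · rw [if_pos hc, if_pos (by simp [hc])]
          exact hne ((α c).1 y) hd
        · rw [if_neg hc, if_neg (by simp [hc, Ne.symm hd])]
          exact hne y hd
  have := key (List.finRange C) (List.nodup_finRange C) x
  rw [if_pos (List.mem_finRange c)] at this
  rw [← List.ofFn_eq_map] at this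
  exact this

/-- The signed indices, sorted by colour. -/
def colourEquiv (w : Fin n → Fin C) : (Σ c, colourClass w c × ℤˣ) ≃ Fin n × ℤˣ where
  toFun x := (x.2.1, x.2.2)
  invFun y := ⟨w y.1, ⟨y.1, mem_colourClass.2 rfl⟩, y.2⟩
  left_inv := by
    rintro ⟨c, ⟨k, hk⟩, s⟩
    obtain rfl := mem_colourClass.1 hk
    rfl
  right_inv _ := rfl

theorem numCycles_premapProd (α : ∀ c, PM (colourClass w c)) :
    numCycles (premapProd α) = ∑ c, numCycles (α c).1 :=
  numCycles_eq_sum_of_sigma (colourEquiv w) fun c x => (premapProd_apply α c x).symm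

theorem forall_signed_iff {p : Fin n × ℤˣ → Prop} :
    (∀ x, p x) ↔ ∀ c, ∀ x : colourClass w c × ℤˣ, p (x.1, x.2) :=
  ⟨fun h _ _ => h _, fun h x => h (w x.1) ⟨⟨x.1, mem_colourClass.2 rfl⟩, x.2⟩⟩

theorem isPremap_premapProd (α : ∀ c, PM (colourClass w c)) : IsPremap (premapProd α) := by
  refine isPremap_of_apply_ne ?_ ?_
  · rw [eq_comm, inv_eq_iff_mul_eq_one]
    apply Equiv.ext
    refine (forall_signed_iff (w := w)).2 fun c x => ?_
    simp only [Equiv.Perm.mul_apply, Equiv.Perm.one_apply]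
    have h1 : ∀ y : colourClass w c × ℤˣ, delta (Fin n) (y.1.1, y.2) =
      ((delta _ y).1.1, (delta _ y).2) := fun y => by simp
    rw [h1, premapProd_apply, h1, premapProd_apply]
    have h2 := (α c).2.inv.delta_apply_apply
    rw [inv_inv] at h2
    have h3 := (α c).2.delta_apply_apply (delta _ x)
    rw [h3, delta_delta, ← Equiv.Perm.mul_apply, mul_inv_cancel, Equiv.Perm.one_apply]
  · refine (forall_signed_iff (w := w)).2 fun c x h => ?_
    rw [premapProd_apply] at h
    refine (α c).2.apply_ne_delta x ?_
    simp only [delta_apply, Prod.mk.injEq] at h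
    ext
    · simp [h.1]
    · simp [h.2]

/-- A cycle of the product stays within one colour, and the inclusion of a colour class preserves
order and sign. -/
theorem mem_FD_premapProd (α : ∀ c, PM (colourClass w c)) (c : Fin C)
    (x : colourClass w c × ℤˣ) : ((x.1.1, x.2) : Fin n × ℤˣ) ∈ FD (premapProd α) ↔
      x ∈ FD (α c).1 := by
  let e : colourClass w c × ℤˣ → Fin n × ℤˣ := fun y => (y.1.1, y.2)
  have he : Function.Injective e := fun y z hyz => by
    simp only [e, Prod.mk.injEq] at hyz
    exact Prod.ext (Subtype.ext hyz.1) hyz.2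
  have hs := sameCycle_iff_of_semiconj he fun y => (premapProd_apply α c y).symm
  have hw : ∀ y, w (premapProd α y).1 = w y.1 := (forall_signed_iff (w := w)).2 fun d y => by
    rw [premapProd_apply]
    exact (mem_colourClass.1 ((α d).1 y).1.2).trans (mem_colourClass.1 y.1.2).symm
  have hrange : ∀ j, (premapProd α).SameCycle (e x) j → ∃ z, j = e z := by
    intro j hj
    have h1 : w (e x).1 = w j.1 := apply_eq_of_sameCycle (g := fun y => w y.1) hw hj
    exact ⟨⟨⟨j.1, mem_colourClass.2 (h1.symm.trans (mem_colourClass.1 x.1.2))⟩, j.2⟩, rfl⟩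
  simp only [FD, Finset.mem_filter, Finset.mem_univ, true_and]
  constructor
  · rintro ⟨m, hm, hmin⟩
    obtain ⟨⟨m', s⟩, hz⟩ := hrange _ hm
    obtain ⟨rfl, rfl⟩ := Prod.mk.inj hz
    exact ⟨m', (hs _ _).2 hm, fun j hj => hmin (e j) ((hs _ _).1 hj)⟩
  · rintro ⟨m, hm, hmin⟩
    refine ⟨m, (hs _ _).1 hm, fun j hj => ?_⟩
    obtain ⟨z, rfl⟩ := hrange j hj
    exact hmin z ((hs _ _).2 hj)

theorem prod_colourClass {M : Type*} [CommMonoid M] (w : Fin n → Fin C) (g : Fin n → M) :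
    ∏ c, ∏ k : colourClass w c, g k = ∏ k, g k := by
  rw [← Finset.prod_fiberwise _ w g]
  refine Finset.prod_congr rfl fun c _ => ?_
  exact Finset.prod_coe_sort (colourClass w c) g

theorem sum_card_colourClass (w : Fin n → Fin C) :
    ∑ c, Fintype.card (colourClass w c) = n := by
  have : ∑ c, ∑ _k : colourClass w c, 1 = ∑ _k : Fin n, 1 :=
    Multiplicative.ofAdd.injective (prod_colourClass w fun _ => Multiplicative.ofAdd 1)
  simpa using this

theorem numCycles_premapProd_ediv (α : ∀ c, PM (colourClass w c)) :
    (numCycles (premapProd α) : ℤ) / 2 = ∑ c, (numCycles (α c).1 : ℤ) / 2 := by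
  rw [numCycles_premapProd]
  have h : ∀ c, numCycles (α c).1 = 2 * (numCycles (α c).1 / 2) := fun c => by
    rw [(α c).2.numCycles_eq (α c).2.isHalf_FD]; simp
  rw [Finset.sum_congr rfl fun c _ => h c, ← Finset.mul_sum]
  push_cast
  simp

theorem prod_zpow_eq_zpow_sum {κ K : Type*} [Field K] {z : K} (hz : z ≠ 0) (s : Finset κ)
    (e : κ → ℤ) : ∏ c ∈ s, z ^ e c = z ^ ∑ c ∈ s, e c := by
  classical
  induction s using Finset.induction_on with
  | empty => simp
  | insert a s ha ih => rw [Finset.prod_insert ha, Finset.sum_insert ha, ih, zpow_add₀ hz]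

/-- Distributing the product of sums gives families of premaps. Constraints, signs and exponents are
local to the colours, so each assembles into that of the product permutation. -/
theorem prod_momentSum {N : ℕ} (hN : 0 < N) (f : Fin C → (I : Finset (Fin n)) → PM I → ℂ)
    (i : Fin n × ℤˣ → Fin N) (η : Fin n × ℤˣ → ℤˣ) :
    ∏ c, momentSum (f c (colourClass w c)) (fun x => i (x.1, x.2)) (fun x => η (x.1, x.2)) =
      ∑ α : ∀ c, PM (colourClass w c) with
        (∀ x, i x = i (delta (Fin n) (premapProd α x))) ∧
          (∀ x, x.2 * η x = (premapProd α x).2 * η (delta (Fin n) (premapProd α x))),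
        (((∏ x ∈ FD (premapProd α), adjointSign η x : ℤˣ) : ℤ) : ℂ) *
          (2 * N : ℂ) ^ ((numCycles (premapProd α) : ℤ) / 2 - n) *
          ∏ c, f c (colourClass w c) (α c) := by
  have h2N : (2 * N : ℂ) ≠ 0 := by
    have : (N : ℂ) ≠ 0 := Nat.cast_ne_zero.2 hN.ne'
    simp [this]
  simp only [momentSum]
  rw [Finset.prod_univ_sum]
  refine Finset.sum_congr ?_ fun α _ => ?_
  · ext α
    simp only [Fintype.mem_piFinset, Finset.mem_filter, Finset.mem_univ, true_and, forall_and]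
    refine and_congr ?_ ?_
    · rw [forall_signed_iff (w := w)]
      simp only [premapProd_apply, delta_apply]
    · rw [forall_signed_iff (w := w)]
      simp only [premapProd_apply, delta_apply]
  · rw [Finset.prod_mul_distrib, Finset.prod_mul_distrib]
    congr 2
    · rw [(isPremap_premapProd α).isHalf_FD.prod_eq, ← prod_colourClass w]
      push_cast
      refine Finset.prod_congr rfl fun c _ => ?_
      rw [Finset.prod_filter]
      refine Finset.prod_congr rfl fun k _ => ?_
      have h1 := mem_FD_premapProd α c (k, -1)
      rw [(isPremap_premapProd α).isHalf_FD.neg_mem] at h1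
      by_cases hk : ((k : Fin n), (1 : ℤˣ)) ∈ FD (premapProd α)
      · simp [← h1, hk, halfSign, adjointSign]
      · simp [← h1, hk, halfSign, adjointSign]
    · rw [prod_zpow_eq_zpow_sum h2N, numCycles_premapProd_ediv, Finset.sum_sub_distrib,
        ← Nat.cast_sum, sum_card_colourClass]

/-- The effect of sign changes on the sign of a half. -/
theorem prod_adjointSign_signFlip {ι : Type*} [Fintype ι] [DecidableEq ι]
    {π : Equiv.Perm (ι × ℤˣ)} {F : Finset (ι × ℤˣ)}
    (h : IsHalf π F) (ε : ι → ℤˣ) (H : ι × ℤˣ → ℤˣ) :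
    (∏ k, adjointSign (fun y => ε y.1 * H (signFlip ε y)) (k, ε k)) *
      ∏ x ∈ F, adjointSign (fun y => ε y.1 * H (signFlip ε y)) x =
    ∏ x ∈ F.map (signFlip ε).toEmbedding, adjointSign H x := by
  rw [Finset.prod_map, h.prod_eq, h.prod_eq, ← Finset.prod_mul_distrib]
  refine Finset.prod_congr rfl fun k _ => ?_
  have := neg_one_ne_one
  rcases Int.units_eq_one_or (ε k) with h1 | h1 <;>
    rcases Int.units_eq_one_or (halfSign F k) with h2 | h2 <;>
    simp [adjointSign, h1, h2, mul_comm]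

theorem IsHalf.map_signFlip {ι : Type*} {π : Equiv.Perm (ι × ℤˣ)} {F : Finset (ι × ℤˣ)}
    (h : IsHalf π F) (ε : ι → ℤˣ) :
    IsHalf (signFlip ε * π * signFlip ε) (F.map (signFlip ε).toEmbedding) := by
  have hmem : ∀ x, x ∈ F.map (signFlip ε).toEmbedding ↔ signFlip ε x ∈ F := fun x => by
    rw [Finset.mem_map_equiv, ← Equiv.Perm.inv_def, signFlip_inv]
  have hsq : ∀ x, signFlip ε (signFlip ε x) = x := fun x => by
    rw [← Equiv.Perm.mul_apply, signFlip_mul_self, Equiv.Perm.one_apply]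
  refine ⟨fun x => ?_, fun x => ?_⟩
  · rw [hmem, hmem, Equiv.Perm.mul_apply, Equiv.Perm.mul_apply, hsq, h.apply_mem]
  · rw [hmem, hmem, ← h.delta_mem, ← Equiv.Perm.mul_apply, signFlip_mul_delta,
      Equiv.Perm.mul_apply]

theorem numCycles_conj_signFlip {ι : Type*} (π : Equiv.Perm (ι × ℤˣ)) (ε : ι → ℤˣ) :
    numCycles (signFlip ε * π * signFlip ε) = numCycles π := by
  have := numCycles_conj_inv (signFlip ε) π
  rwa [signFlip_inv] at this

end PremapProd

/-! ### Expansion over the faces -/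

section Faces

variable {ι : Type*} [Fintype ι] [LinearOrder ι] {N : ℕ}

theorem sum_signed_functions {T M : Type*} [Fintype T] [AddCommMonoid M]
    (Φ : (ι → T) → (ι → T) → M) :
    ∑ A : ι × ℤˣ → T, Φ (fun k => A (k, 1)) (fun k => A (k, -1)) = ∑ i, ∑ j, Φ i j := by
  rw [← Fintype.sum_prod_type']
  refine Fintype.sum_equiv
    { toFun := fun A => (fun k => A (k, 1), fun k => A (k, -1))
      invFun := fun p (x : ι × ℤˣ) => if x.2 = (1 : ℤˣ) then p.1 x.1 else p.2 x.1
      left_inv := fun A => by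
        funext ⟨k, s⟩
        rcases Int.units_eq_one_or s with rfl | rfl <;> simp
      right_inv := fun p => by simp } _ _ fun A => rfl

/-- `FD` is the set of positive indices, and the labels at negative indices are determined by i(-k)
= i(φ(k)). -/
theorem reTr_facePremap (φRe φtr : Equiv.Perm ι)
    (A : ι → Matrix (Fin N) (Fin N) (Quaternion ℝ)) :
    reTr (facePremap φRe) (facePremap φtr) A =
      (2 : ℂ) ^ (-(numCycles φRe : ℤ)) * (N : ℂ) ^ (-(numCycles φtr : ℤ)) *
        ∑ i : ι → Fin N, ∑ h : ι → ℤˣ, ∏ k, entry (A k) (i k) (i (φtr k)) (h k) (h (φRe k)) := by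
  rw [reTr, numCycles_facePremap, numCycles_facePremap]
  push_cast
  rw [Int.mul_ediv_cancel_left _ two_ne_zero, Int.mul_ediv_cancel_left _ two_ne_zero]
  congr 1
  let e : ι ≃ FD (facePremap φRe) :=
    { toFun := fun k => ⟨(k, 1), (mem_FD_facePremap φRe _).2 rfl⟩
      invFun := fun x => x.1.1
      left_inv := fun k => rfl
      right_inv := fun x => by
        have := (mem_FD_facePremap φRe _).1 x.2
        ext <;> simp [this] }
  have he : ∀ k, fdPerm (facePremap φRe) (e k) = e (φRe k) := fun k =>
    Subtype.ext (facePremap_apply_one φRe k)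
  refine Finset.sum_bij' (fun i _ k => i (k, 1))
    (fun i _ x => if x.2 = 1 then i x.1 else i (φtr x.1)) (by simp) ?_ ?_ (by simp) ?_
  · intro i _
    simp only [Finset.mem_filter, Finset.mem_univ, true_and]
    rintro ⟨k, s⟩
    rcases Int.units_eq_one_or s with rfl | rfl
    · simp
    · simp
  · intro i hi
    simp only [Finset.mem_filter, Finset.mem_univ, true_and] at hi
    funext ⟨k, s⟩
    rcases Int.units_eq_one_or s with rfl | rfl
    · simp
    · have := hi (k, 1)
      simpa using this
  · intro i hi
    simp only [Finset.mem_filter, Finset.mem_univ, true_and] at hi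
    refine Fintype.sum_equiv (e.arrowCongr (Equiv.refl _)).symm _ _ fun h => ?_
    rw [← e.prod_comp]
    refine Finset.prod_congr rfl fun k _ => ?_
    rw [he]
    simp [e, signedMatrix]

theorem reTr_facePremap_mul (φRe φtr : Equiv.Perm ι)
    (A B : ι → Matrix (Fin N) (Fin N) (Quaternion ℝ)) :
    reTr (facePremap φRe) (facePremap φtr) (fun k => A k * B k) =
      (2 : ℂ) ^ (-(numCycles φRe : ℤ)) * (N : ℂ) ^ (-(numCycles φtr : ℤ)) *
        ∑ i : ι × ℤˣ → Fin N, ∑ h : ι × ℤˣ → ℤˣ,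
          (∏ k, entry (A k) (i (k, 1)) (i (k, -1)) (h (k, 1)) (h (k, -1))) *
          ∏ k, entry (B k) (i (k, -1)) (i (φtr k, 1)) (h (k, -1)) (h (φRe k, 1)) := by
  rw [reTr_facePremap]
  congr 1
  have h1 : ∀ i : ι × ℤˣ → Fin N, ∑ h : ι × ℤˣ → ℤˣ,
      (∏ k, entry (A k) (i (k, 1)) (i (k, -1)) (h (k, 1)) (h (k, -1))) *
        ∏ k, entry (B k) (i (k, -1)) (i (φtr k, 1)) (h (k, -1)) (h (φRe k, 1)) =
      ∑ h : ι → ℤˣ, ∑ g : ι → ℤˣ,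
        (∏ k, entry (A k) (i (k, 1)) (i (k, -1)) (h k) (g k)) *
          ∏ k, entry (B k) (i (k, -1)) (i (φtr k, 1)) (g k) (h (φRe k)) := fun i =>
    sum_signed_functions fun h g =>
      (∏ k, entry (A k) (i (k, 1)) (i (k, -1)) (h k) (g k)) *
        ∏ k, entry (B k) (i (k, -1)) (i (φtr k, 1)) (g k) (h (φRe k))
  simp only [h1]
  rw [sum_signed_functions fun i j => ∑ h : ι → ℤˣ, ∑ g : ι → ℤˣ,
        (∏ k, entry (A k) (i k) (j k) (h k) (g k)) *
          ∏ k, entry (B k) (j k) (i (φtr k)) (g k) (h (φRe k))]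
  refine Finset.sum_congr rfl fun i _ => ?_
  rw [Finset.sum_comm]
  refine Finset.sum_congr rfl fun h _ => ?_
  simp only [entry_mul, Finset.prod_univ_sum, Fintype.piFinset_univ, Finset.prod_mul_distrib]

end Faces

/-! ### Independence and factorisation of expectations -/

section Probability

variable {Ω : Type*} [MeasurableSpace Ω] {μ : Measure Ω} [IsProbabilityMeasure μ]

theorem integrable_prod_of_iIndepFun {κ : Type*} [Fintype κ] {Z : κ → Ω → ℂ}
    (h : iIndepFun Z μ) (hm : ∀ c, Measurable (Z c)) (hZ : ∀ c, Integrable (Z c) μ) :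
    Integrable (fun ω => ∏ c, Z c ω) μ := by
  have hmap := h.map_fun_eq_pi_map fun c => (hm c).aemeasurable
  have hp : ∀ c, IsProbabilityMeasure (μ.map (Z c)) := fun c =>
    Measure.isProbabilityMeasure_map (hm c).aemeasurable
  have h1 : Integrable (fun x : κ → ℂ => ∏ c, x c) (Measure.pi fun c => μ.map (Z c)) := by
    refine Integrable.fintype_prod (f := fun _ z => z) fun c => ?_
    exact (integrable_map_measure aestronglyMeasurable_id (hm c).aemeasurable).2 (hZ c)
  rw [← hmap] at h1
  exact h1.comp_aemeasurable (measurable_pi_iff.2 hm).aemeasurable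

variable {n C N : ℕ}

theorem measurable_prod_entry {I : Type*} [Fintype I] (κ : I → Fin n) (i j : I → Fin N)
    (η θ : I → ℤˣ) : Measurable fun B : Fin n → Fin N → Fin N → Quaternion ℝ =>
      ∏ k, entry (B (κ k) : Matrix (Fin N) (Fin N) (Quaternion ℝ)) (i k) (j k) (η k) (θ k) := by
  refine Finset.measurable_fun_prod _ fun k _ => measurable_entry ?_ _ _
  fun_prop

theorem integral_prod_entry {X : Fin C → Fin n → Ω → Matrix (Fin N) (Fin N) (Quaternion ℝ)}
    (hN : 0 < N)
    (hXmeas : ∀ c k i j, Measurable fun ω => X c k ω i j)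
    (hXindep : iIndepFun (fun c ω k i j => X c k ω i j) μ)
    (hXint : ∀ (c : Fin C) (I : Finset (Fin n)) (i : I × ℤˣ → Fin N) (η : I × ℤˣ → ℤˣ),
      Integrable (fun ω => ∏ k : I,
        entry (X c k ω) (i (k, 1)) (i (k, -1)) (η (k, 1)) (η (k, -1))) μ)
    {f : Fin C → (I : Finset (Fin n)) → PM I → ℂ}
    (hX : ∀ (c : Fin C) (I : Finset (Fin n)) (i : I × ℤˣ → Fin N) (η : I × ℤˣ → ℤˣ),
      ∫ ω, ∏ k : I, entry (X c k ω) (i (k, 1)) (i (k, -1)) (η (k, 1)) (η (k, -1)) ∂μ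
        = momentSum (f c I) i η)
    (w : Fin n → Fin C) (i : Fin n × ℤˣ → Fin N) (η : Fin n × ℤˣ → ℤˣ) :
    Integrable (fun ω => ∏ k,
      entry (X (w k) k ω) (i (k, 1)) (i (k, -1)) (η (k, 1)) (η (k, -1))) μ ∧
    ∫ ω, ∏ k, entry (X (w k) k ω) (i (k, 1)) (i (k, -1)) (η (k, 1)) (η (k, -1)) ∂μ =
      ∑ α : ∀ c, PM (colourClass w c) with
        (∀ x, i x = i (delta (Fin n) (premapProd α x))) ∧
          (∀ x, x.2 * η x = (premapProd α x).2 * η (delta (Fin n) (premapProd α x))),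
        (((∏ x ∈ FD (premapProd α), adjointSign η x : ℤˣ) : ℤ) : ℂ) *
          (2 * N : ℂ) ^ ((numCycles (premapProd α) : ℤ) / 2 - n) *
          ∏ c, f c (colourClass w c) (α c) := by
  let Z : Fin C → Ω → ℂ := fun c ω => ∏ k : colourClass w c,
    entry (X c k ω) (i (k, 1)) (i (k, -1)) (η (k, 1)) (η (k, -1))
  have hprod : ∀ ω, ∏ k, entry (X (w k) k ω) (i (k, 1)) (i (k, -1)) (η (k, 1)) (η (k, -1)) =
      ∏ c, Z c ω := fun ω => by
    rw [← prod_colourClass w]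
    refine Finset.prod_congr rfl fun c _ => Finset.prod_congr rfl fun k _ => ?_
    rw [mem_colourClass.1 k.2]
  have hZmeas : ∀ c, Measurable (Z c) := fun c =>
    Finset.measurable_fun_prod _ fun k _ => measurable_entry (hXmeas c k _ _) _ _
  have hZindep : iIndepFun Z μ := hXindep.comp
    (fun c B => ∏ k : colourClass w c, entry (B k : Matrix (Fin N) (Fin N) (Quaternion ℝ))
      (i (k, 1)) (i (k, -1)) (η (k, 1)) (η (k, -1)))
    fun c => measurable_prod_entry (fun k : colourClass w c => (k : Fin n)) _ _ _ _
  have hZint : ∀ c, Integrable (Z c) μ := fun c =>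
    hXint c (colourClass w c) (fun x => i (x.1, x.2)) fun x => η (x.1, x.2)
  simp only [hprod]
  refine ⟨integrable_prod_of_iIndepFun hZindep hZmeas hZint, ?_⟩
  rw [hZindep.integral_fun_prod_eq_prod_integral fun c => (hZmeas c).aestronglyMeasurable,
    ← prod_momentSum hN]
  exact Finset.prod_congr rfl fun c _ =>
    hX c (colourClass w c) (fun x => i (x.1, x.2)) fun x => η (x.1, x.2)

end Probability

/-- A premap and its conjugate by a sign change impose corresponding conditions. -/
theorem conj_signFlip_conditions {ι T : Type*} (π : Equiv.Perm (ι × ℤˣ)) (ε : ι → ℤˣ)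
    (i : ι × ℤˣ → T) (H : ι × ℤˣ → ℤˣ) :
    ((∀ x, i (signFlip ε x) = i (signFlip ε (delta ι (π x)))) ∧
      ∀ x, x.2 * (ε x.1 * H (signFlip ε x)) =
        (π x).2 * (ε (delta ι (π x)).1 * H (signFlip ε (delta ι (π x))))) ↔
    (∀ x, i x = i (delta ι ((signFlip ε * π * signFlip ε) x))) ∧
      ∀ x, x.2 * H x = ((signFlip ε * π * signFlip ε) x).2 *
        H (delta ι ((signFlip ε * π * signFlip ε) x)) := by
  have hsq : ∀ x, signFlip ε (signFlip ε x) = x := fun x => by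
    rw [← Equiv.Perm.mul_apply, signFlip_mul_self, Equiv.Perm.one_apply]
  have hcomm : ∀ x, signFlip ε (delta ι x) = delta ι (signFlip ε x) := fun x => by
    rw [← Equiv.Perm.mul_apply, signFlip_mul_delta, Equiv.Perm.mul_apply]
  have h1 : ∀ x : ι × ℤˣ, (signFlip ε x).2 = ε x.1 * x.2 := fun _ => rfl
  rw [← (signFlip ε).forall_congr_right (q := fun x =>
    i x = i (delta ι ((signFlip ε * π * signFlip ε) x))),
    ← (signFlip ε).forall_congr_right (q := fun x => x.2 * H x =
      ((signFlip ε * π * signFlip ε) x).2 * H (delta ι ((signFlip ε * π * signFlip ε) x)))]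
  simp only [Equiv.Perm.mul_apply, hsq, hcomm, h1]
  refine and_congr Iff.rfl (forall_congr' fun x => ?_)
  rw [mul_left_comm, mul_assoc (ε x.1), show (delta ι (π x)).1 = (π x).1 from rfl,
    mul_left_comm (π x).2, mul_assoc (ε (π x).1)]

/-- Here `b`, `k`, `k'` are half the cycle counts of the premap and of its two vertex permutations.
The sign cancels because the two exponents of -1 add up to 2(b + k). -/
theorem prefactor_eq {N : ℕ} (hN : 0 < N) (n a a' b k k' : ℕ) :
    (2 : ℂ) ^ (-(a : ℤ)) * (N : ℂ) ^ (-(a' : ℤ)) * (2 * N : ℂ) ^ ((b : ℤ) - n) =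
      (-2 : ℂ) ^ ((a : ℤ) + b + k - n - 2 * a) * (N : ℂ) ^ ((a' : ℤ) + b + k' - n - 2 * a') *
        ((2 : ℂ) ^ (-(k : ℤ)) * (N : ℂ) ^ (-(k' : ℤ)) * (-1) ^ (n + a + b + k)) := by
  have hN0 : (N : ℂ) ≠ 0 := Nat.cast_ne_zero.2 hN.ne'
  have h2 : (2 : ℂ) ≠ 0 := two_ne_zero
  have hm : (-1 : ℂ) ≠ 0 := by norm_num
  have h1 : (-1 : ℂ) ^ ((a : ℤ) + b + k - n - 2 * a) * (-1) ^ (n + a + b + k) = 1 := by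
    rw [← zpow_natCast, ← zpow_add₀ hm]
    exact Even.neg_one_zpow ⟨(b : ℤ) + k, by push_cast; ring⟩
  have e2 : (2 : ℂ) ^ ((a : ℤ) + b + k - n - 2 * a) * 2 ^ (-(k : ℤ)) =
      2 ^ (-(a : ℤ)) * 2 ^ ((b : ℤ) - n) := by
    rw [← zpow_add₀ h2, ← zpow_add₀ h2]; congr 1; ring
  have eN : (N : ℂ) ^ ((a' : ℤ) + b + k' - n - 2 * a') * (N : ℂ) ^ (-(k' : ℤ)) =
      (N : ℂ) ^ (-(a' : ℤ)) * (N : ℂ) ^ ((b : ℤ) - n) := by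
    rw [← zpow_add₀ hN0, ← zpow_add₀ hN0]; congr 1; ring
  rw [show (-2 : ℂ) = -1 * 2 by norm_num, mul_zpow, mul_zpow]
  calc _ = (2 ^ (-(a : ℤ)) * 2 ^ ((b : ℤ) - n)) *
        ((N : ℂ) ^ (-(a' : ℤ)) * (N : ℂ) ^ ((b : ℤ) - n)) *
        ((-1 : ℂ) ^ ((a : ℤ) + b + k - n - 2 * a) * (-1) ^ (n + a + b + k)) := by rw [h1]; ring
    _ = _ := by rw [← e2, ← eN]; ring

theorem eulerChar_eq {ι : Type*} [Fintype ι] [LinearOrder ι] (φ : Equiv.Perm ι)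
    (β : Equiv.Perm (ι × ℤˣ)) : eulerChar φ β = (numCycles φ : ℤ) + (numCycles β / 2 : ℕ)
      + (numCycles (vertexPerm φ β) / 2 : ℕ) - Fintype.card ι := by
  rw [eulerChar, numCycles_facePremap]
  push_cast
  rw [Int.mul_ediv_cancel_left _ two_ne_zero]

theorem integral_reTr_vertexPerm {Ω : Type*} [MeasurableSpace Ω] {μ : Measure Ω}
    {ι : Type*} [Fintype ι] [LinearOrder ι] {N : ℕ}
    {Y : ι → Ω → Matrix (Fin N) (Fin N) (Quaternion ℝ)}
    (hYint : ∀ (i j : ι → Fin N) (η θ : ι → ℤˣ),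
      Integrable (fun ω => ∏ k, entry (Y k ω) (i k) (j k) (η k) (θ k)) μ)
    {β : Equiv.Perm (ι × ℤˣ)} {F : Finset (ι × ℤˣ)} (hβ : IsPremap β) (hF : IsHalf β F)
    (φRe φtr : Equiv.Perm ι) :
    ∫ ω, reTr (vertexPerm φRe β)⁻¹ (vertexPerm φtr β)⁻¹ (fun k => Y k ω) ∂μ =
      ((2 : ℂ) ^ (-((numCycles (vertexPerm φRe β) / 2 : ℕ) : ℤ)) *
        (N : ℂ) ^ (-((numCycles (vertexPerm φtr β) / 2 : ℕ) : ℤ)) *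
        (-1) ^ (Fintype.card ι + numCycles φRe + numCycles β / 2
          + numCycles (vertexPerm φRe β) / 2)) *
      ∑ A : ι × ℤˣ → Fin N with ∀ x, A x = A (delta ι (β x)),
        ∑ H : ι × ℤˣ → ℤˣ with ∀ x, x.2 * H x = (β x).2 * H (delta ι (β x)),
          (((∏ x ∈ F, adjointSign H x : ℤˣ) : ℤ) : ℂ) *
            ∫ ω, ∏ k, entry (Y k ω) (A (k, -1)) (A (φtr k, 1)) (H (k, -1)) (H (φRe k, 1)) ∂μ := by
  have hint : ∀ (A : ι × ℤˣ → Fin N) (H : ι × ℤˣ → ℤˣ), Integrable (fun ω =>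
      (((∏ x ∈ F, adjointSign H x : ℤˣ) : ℤ) : ℂ) *
        ∏ k, entry (Y k ω) (A (k, -1)) (A (φtr k, 1)) (H (k, -1)) (H (φRe k, 1))) μ :=
    fun A H => (hYint _ _ _ _).const_mul _
  have hsgn : ∀ (z x : ℂ) (m : ℕ), z * (-1) ^ m * ((-1) ^ m * x) = z * x := fun z x m => by
    rw [mul_assoc, ← mul_assoc (_ ^ m), ← mul_pow, neg_one_mul, neg_neg, one_pow, one_mul]
  have hcore : ∀ ω, reTr (vertexPerm φRe β)⁻¹ (vertexPerm φtr β)⁻¹ (fun k => Y k ω) =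
      ((2 : ℂ) ^ (-((numCycles (vertexPerm φRe β) / 2 : ℕ) : ℤ)) *
        (N : ℂ) ^ (-((numCycles (vertexPerm φtr β) / 2 : ℕ) : ℤ)) *
        (-1) ^ (Fintype.card ι + numCycles φRe + numCycles β / 2
          + numCycles (vertexPerm φRe β) / 2)) *
      ∑ A : ι × ℤˣ → Fin N with ∀ x, A x = A (delta ι (β x)),
        ∑ H : ι × ℤˣ → ℤˣ with ∀ x, x.2 * H x = (β x).2 * H (delta ι (β x)),
          (((∏ x ∈ F, adjointSign H x : ℤˣ) : ℤ) : ℂ) *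
            ∏ k, entry (Y k ω) (A (k, -1)) (A (φtr k, 1)) (H (k, -1)) (H (φRe k, 1)) := by
    intro ω
    rw [sum_alternating_eq hβ hF φRe φtr fun k => Y k ω, hsgn, reTr, numCycles_inv, numCycles_inv]
    push_cast
    rfl
  simp only [hcore]
  rw [integral_const_mul, integral_finsetSum _ fun A _ =>
    integrable_finsetSum _ fun H _ => hint A H]
  congr 1
  refine Finset.sum_congr rfl fun A _ => ?_
  rw [integral_finsetSum _ fun H _ => hint A H]
  simp only [integral_const_mul]

end QuatExpansion

theorem mainTheorem1 {Ω : Type*} [MeasurableSpace Ω] (μ : Measure Ω) [IsProbabilityMeasure μ]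
    (n C N : ℕ) (hN : 0 < N)
    (X : Fin C → Fin n → Ω → Matrix (Fin N) (Fin N) (Quaternion ℝ))
    (hXmeas : ∀ c k i j, Measurable fun ω => X c k ω i j)
    -- the families, one for each `c`, are independent
    (hXindep : iIndepFun (fun c ω k i j => X c k ω i j) μ)
    -- the expectations in the hypothesis exist
    (hXint : ∀ (c : Fin C) (I : Finset (Fin n)) (i : I × ℤˣ → Fin N) (η : I × ℤˣ → ℤˣ),
      Integrable (fun ω => ∏ k : I,
        entry (X c k ω) (i (k, 1)) (i (k, -1)) (η (k, 1)) (η (k, -1))) μ)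
    (f : Fin C → (I : Finset (Fin n)) → PM I → ℂ)
    (hX : ∀ (c : Fin C) (I : Finset (Fin n)) (i : I × ℤˣ → Fin N) (η : I × ℤˣ → ℤˣ),
      ∫ ω, ∏ k : I, entry (X c k ω) (i (k, 1)) (i (k, -1)) (η (k, 1)) (η (k, -1)) ∂μ
        = momentSum (f c I) i η)
    (φRe φtr : Equiv.Perm (Fin n)) (w : Fin n → Fin C) (ε : Fin n → ℤˣ)
    (Y : Fin n → Ω → Matrix (Fin N) (Fin N) (Quaternion ℝ))
    (hYmeas : ∀ k i j, Measurable fun ω => Y k ω i j)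
    -- the matrices `Y k` are jointly independent from the matrices `X (w k) k`
    (hXY : IndepFun (fun ω k i j => X (w k) k ω i j) (fun ω k i j => Y k ω i j) μ)
    -- the mixed moments of order `n` of the matrices `Y k` exist
    (hYint : ∀ (i j : Fin n → Fin N) (η θ : Fin n → ℤˣ),
      Integrable (fun ω => ∏ k, entry (Y k ω) (i k) (j k) (η k) (θ k)) μ) :
    Integrable (fun ω => reTr (facePremap φRe) (facePremap φtr)
      fun k => signedMatrix (fun l => X (w l) l ω) (k, ε k) * Y k ω) μ ∧
    ∫ ω, reTr (facePremap φRe) (facePremap φtr)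
        (fun k => signedMatrix (fun l => X (w l) l ω) (k, ε k) * Y k ω) ∂μ
      = ∑ α : ∀ c, PM (colourClass w c),
          (-2 : ℂ) ^ (eulerChar φRe (signFlip ε * premapProd α * signFlip ε)
              - 2 * (numCycles φRe : ℤ)) *
          (N : ℂ) ^ (eulerChar φtr (signFlip ε * premapProd α * signFlip ε)
              - 2 * (numCycles φtr : ℤ)) *
          (∏ c, f c (colourClass w c) (α c)) *
          ∫ ω, reTr (vertexPerm φRe (signFlip ε * premapProd α * signFlip ε))⁻¹
            (vertexPerm φtr (signFlip ε * premapProd α * signFlip ε))⁻¹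
            (fun k => Y k ω) ∂μ := by
  -- the products of entries of the two families
  let PX : (Fin n × ℤˣ → Fin N) → (Fin n × ℤˣ → ℤˣ) → Ω → ℂ := fun i h ω =>
    ∏ k, entry (X (w k) k ω) (i (signFlip ε (k, 1))) (i (signFlip ε (k, -1)))
      (ε k * h (signFlip ε (k, 1))) (ε k * h (signFlip ε (k, -1)))
  let PY : (Fin n × ℤˣ → Fin N) → (Fin n × ℤˣ → ℤˣ) → Ω → ℂ := fun i h ω =>
    ∏ k, entry (Y k ω) (i (k, -1)) (i (φtr k, 1)) (h (k, -1)) (h (φRe k, 1))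
  -- The sign from replacing the prescribed adjoints by entries of the `X` themselves.
  let s : (Fin n × ℤˣ → ℤˣ) → ℤˣ := fun h =>
    ∏ k, adjointSign (fun y => ε y.1 * h (signFlip ε y)) (k, ε k)
  have hcore : ∀ ω, reTr (facePremap φRe) (facePremap φtr)
      (fun k => signedMatrix (fun l => X (w l) l ω) (k, ε k) * Y k ω) =
      (2 : ℂ) ^ (-(numCycles φRe : ℤ)) * (N : ℂ) ^ (-(numCycles φtr : ℤ)) *
        ∑ i : Fin n × ℤˣ → Fin N, ∑ h : Fin n × ℤˣ → ℤˣ,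
          ((s h : ℤ) : ℂ) * (PX i h ω * PY i h ω) := by
    intro ω
    rw [reTr_facePremap_mul]
    congr 1
    refine Finset.sum_congr rfl fun i _ => Finset.sum_congr rfl fun h _ => ?_
    rw [← mul_assoc]
    congr 1
    simp only [s, PX]
    push_cast
    rw [← Finset.prod_mul_distrib]
    refine Finset.prod_congr rfl fun k _ => ?_
    have := entry_signedMatrix (fun l => X (w l) l ω) (fun y => i (signFlip ε y))
      (fun y => ε y.1 * h (signFlip ε y)) (k, ε k)
    rw [← this]
    simp [← mul_assoc]
  have hPX : ∀ i h, Integrable (PX i h) μ ∧ ∫ ω, PX i h ω ∂μ = _ := fun i h =>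
    integral_prod_entry hN hXmeas hXindep hXint hX w (fun y => i (signFlip ε y))
      (fun y => ε y.1 * h (signFlip ε y))
  have hPY : ∀ i h, Integrable (PY i h) μ := fun i h => hYint _ _ _ _
  have hind : ∀ i h, IndepFun (PX i h) (PY i h) μ := fun i h =>
    hXY.comp (measurable_prod_entry (fun k => k) _ _ _ _) (measurable_prod_entry (fun k => k) _ _ _ _)
  have hterm : ∀ i h, Integrable (fun ω => ((s h : ℤ) : ℂ) * (PX i h ω * PY i h ω)) μ :=
    fun i h => ((hind i h).integrable_mul (hPX i h).1 (hPY i h)).const_mul _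
  have hsum : Integrable (fun ω => ∑ i : Fin n × ℤˣ → Fin N, ∑ h : Fin n × ℤˣ → ℤˣ,
      ((s h : ℤ) : ℂ) * (PX i h ω * PY i h ω)) μ :=
    integrable_finsetSum _ fun i _ => integrable_finsetSum _ fun h _ => hterm i h
  simp only [hcore]
  refine ⟨hsum.const_mul _, ?_⟩
  rw [integral_const_mul, integral_finsetSum _ fun i _ =>
    integrable_finsetSum _ fun h _ => hterm i h]
  have hvalue : ∀ i h, ∫ ω, ((s h : ℤ) : ℂ) * (PX i h ω * PY i h ω) ∂μ =
      ∑ α : ∀ c, PM (colourClass w c),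
        if ∀ x, i x = i (delta (Fin n) ((signFlip ε * premapProd α * signFlip ε) x)) then
          if ∀ x, x.2 * h x = ((signFlip ε * premapProd α * signFlip ε) x).2 *
              h (delta (Fin n) ((signFlip ε * premapProd α * signFlip ε) x)) then
            ((2 * N : ℂ) ^ ((numCycles (premapProd α) : ℤ) / 2 - n) *
              ∏ c, f c (colourClass w c) (α c)) *
            ((((∏ x ∈ (FD (premapProd α)).map (signFlip ε).toEmbedding, adjointSign h x : ℤˣ) : ℤ)
              : ℂ) * ∫ ω, PY i h ω ∂μ)
          else 0
        else 0 := by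
    intro i h
    rw [integral_const_mul, (hind i h).integral_fun_mul_eq_mul_integral
      (hPX i h).1.aestronglyMeasurable (hPY i h).aestronglyMeasurable, (hPX i h).2,
      Finset.sum_filter, Finset.sum_mul, Finset.mul_sum]
    refine Finset.sum_congr rfl fun α _ => ?_
    simp only [← ite_and]
    rw [← if_congr (conj_signFlip_conditions (premapProd α) ε i h) rfl rfl]
    split_ifs with hc
    -- The adjoint signs from ε merge with the sign of `FD(α)` into the sign of the flipped half, a
    -- half of α^ε.
    · rw [← prod_adjointSign_signFlip (isPremap_premapProd α).isHalf_FD ε h]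
      simp only [s]
      push_cast
      ring
    · simp
  have hswap : ∀ i, ∫ ω, ∑ h, ((s h : ℤ) : ℂ) * (PX i h ω * PY i h ω) ∂μ =
      ∑ h, ∫ ω, ((s h : ℤ) : ℂ) * (PX i h ω * PY i h ω) ∂μ :=
    fun i => integral_finsetSum _ fun h _ => hterm i h
  simp only [hswap, hvalue]
  have hcomm : ∀ g : (Fin n × ℤˣ → Fin N) → (Fin n × ℤˣ → ℤˣ) →
      (∀ c, PM (colourClass w c)) → ℂ, ∑ i, ∑ h, ∑ α, g i h α = ∑ α, ∑ i, ∑ h, g i h α :=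
    fun g => (Finset.sum_congr rfl fun i _ => Finset.sum_comm).trans Finset.sum_comm
  rw [hcomm, Finset.mul_sum]
  refine Finset.sum_congr rfl fun α _ => ?_
  have hβ := (isPremap_premapProd α).conj_signFlip ε
  have hF := (isPremap_premapProd α).isHalf_FD.map_signFlip ε
  rw [integral_reTr_vertexPerm hYint hβ hF, eulerChar_eq, eulerChar_eq]
  have hpre := prefactor_eq hN n (numCycles φRe) (numCycles φtr)
    (numCycles (signFlip ε * premapProd α * signFlip ε) / 2)
    (numCycles (vertexPerm φRe (signFlip ε * premapProd α * signFlip ε)) / 2)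
    (numCycles (vertexPerm φtr (signFlip ε * premapProd α * signFlip ε)) / 2)
  -- Conjugation by the sign changes preserves the number of cycles, so the exponent from the moment
  -- formula can be read with α^ε.
  rw [show ((numCycles (signFlip ε * premapProd α * signFlip ε) / 2 : ℕ) : ℤ) - n =
    (numCycles (premapProd α) : ℤ) / 2 - n by rw [numCycles_conj_signFlip]; push_cast; rfl] at hpre
  have hsums : ∀ (z : ℂ) (p : (Fin n × ℤˣ → Fin N) → Prop) (q : (Fin n × ℤˣ → ℤˣ) → Prop)
      [DecidablePred p] [DecidablePred q] (g : (Fin n × ℤˣ → Fin N) → (Fin n × ℤˣ → ℤˣ) → ℂ),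
      ∑ i, ∑ h, (if p i then if q h then z * g i h else 0 else 0) =
        z * ∑ i with p i, ∑ h with q h, g i h := by
    intro z p q _ _ g
    rw [Finset.mul_sum, Finset.sum_filter]
    refine Finset.sum_congr rfl fun i _ => ?_
    split_ifs
    · rw [Finset.mul_sum, Finset.sum_filter]
    · simp
  rw [hsums, Fintype.card_fin, ← mul_assoc, ← mul_assoc, hpre]
  simp only [PY]
  ring
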